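/- A density on $\mathbb{R}$ is a positive function $f$; it weights both volume and perimeter. A triple bubble with prescribed volumes $0<V_1\le V_2\le V_3$ is a triple of measurable sets $E_1,E_2,E_3\subset\mathbb{R}$ (the bubbles), pairwise disjoint up to null sets and not necessarily connected, with $\int_{E_i}f=V_i$. Its perimeter is $\sum_x f(x)$, summed over the points $x$ of the union of the measure-theoretic boundaries of $E_1,E_2,E_3$ (the points all of whose neighborhoods meet both $E_i$ and its complement in positive measure); a point that bounds several bubbles is counted once. The triple bubble is perimeter minimizing if its perimeter is least among all triple bubbles with the same prescribed volumes. It is of type $n_1n_2\cdots n_m$ (a word in the labels $1,2,3$) if there are points $x_0<x_1<\dots<x_m$ such that, up to null sets, each $E_n$ is the union of the intervals $[x_{j-1},x_j]$ with $n_j=n$; labels of bubbles with equal prescribed volumes may be interchanged. **Theorem.** (a) Let $f$ be a density on $\mathbb{R}$ that is symmetric ($f(-x)=f(x)$), log-convex and uniquely minimized at the origin, and let $0<V_1\le V_2\le V_3$. Then every perimeter-minimizing triple bubble with prescribed volumes $V_1,V_2,V_3$ is, up to reflection in the origin, of one of the four types $213$, $3123$, $2313$, $32123$. (b) There exists a symmetric,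 strictly log-convex, $C^1$ density on $\mathbb{R}$ such that each of the four types is perimeter minimizing for some prescribed volumes; that is, for each of the four types there are volumes $0<V_1\le V_2\le V_3$ and a perimeter-minimizing triple bubble with these volumes that is of this type. -/

import Mathlib

open Set MeasureTheory
open scoped ENNReal

/-- The measure-theoretic boundary of `E ⊆ ℝ`: the points all of whose neighbourhoods meet both
`E` and its complement in positive Lebesgue measure. It depends only on the class of `E` modulo
null sets. For a finite union of disjoint nondegenerate intervals with disjoint closures it is
the set of endpoints; it is locally finite exactly when `E` has locally finite perimeter. -/
def essBoundary (E : Set ℝ) : Set ℝ :=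
  {x | ∀ r : ℝ, 0 < r →
    0 < volume (Ioo (x - r) (x + r) ∩ E) ∧ 0 < volume (Ioo (x - r) (x + r) \ E)}

/-- Volume of a region on the line with density `f`. -/
noncomputable def weightedVolume (f : ℝ → ℝ) (E : Set ℝ) : ℝ≥0∞ :=
  ∫⁻ x in E, ENNReal.ofReal (f x)

/-- Perimeter of a triple of regions on the line with density `f`: the sum of `f` over all
boundary points, where a point that bounds several regions is counted once. -/
noncomputable def weightedPerimeter (f : ℝ → ℝ) (E : Fin 3 → Set ℝ) : ℝ≥0∞ :=
  ∑' x : (⋃ i, essBoundary (E i) : Set ℝ), ENNReal.ofReal (f x)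

/-- A triple bubble with prescribed volumes `V`: three regions, disjoint up to null sets, the
region `E i` having volume `V i`. Regions need not be connected. The bubbles 1, 2, 3 with
volumes `V₁ ≤ V₂ ≤ V₃` have the indices `0`, `1`, `2`. -/
structure IsTripleBubble (f : ℝ → ℝ) (V : Fin 3 → ℝ) (E : Fin 3 → Set ℝ) : Prop where
  measurable : ∀ i, MeasurableSet (E i)
  disjoint : Pairwise fun i j => AEDisjoint volume (E i) (E j)
  volume_eq : ∀ i, weightedVolume f (E i) = ENNReal.ofReal (V i)

/-- A triple bubble of least perimeter among all triple bubbles with the same volumes. -/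
def IsPerimeterMinimizing (f : ℝ → ℝ) (V : Fin 3 → ℝ) (E : Fin 3 → Set ℝ) : Prop :=
  IsTripleBubble f V E ∧
    ∀ E' : Fin 3 → Set ℝ, IsTripleBubble f V E' →
      weightedPerimeter f E ≤ weightedPerimeter f E'

/-- `E` consists of contiguous compact nondegenerate intervals which, from left to right, belong
to the bubbles listed in the word `w`. -/
def HasLayout (w : List (Fin 3)) (E : Fin 3 → Set ℝ) : Prop :=
  ∃ x : Fin (w.length + 1) → ℝ, StrictMono x ∧
    ∀ i, E i =ᵐ[volume] ⋃ j : Fin w.length, ⋃ _ : w.get j = i, Icc (x j.castSucc) (x j.succ)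

/-- `E` has the layout `w`, where the label `n` stands for "the bubble with volume `Vₙ`":
bubbles with equal volumes may exchange their labels. -/
def IsOfType (V : Fin 3 → ℝ) (w : List (Fin 3)) (E : Fin 3 → Set ℝ) : Prop :=
  ∃ σ : Equiv.Perm (Fin 3), (∀ i, V (σ i) = V i) ∧ HasLayout w (fun i => E (σ i))

/-- The reflection of a triple of regions in the origin. -/
def reflectBubble (E : Fin 3 → Set ℝ) : Fin 3 → Set ℝ := fun i => {x | -x ∈ E i}

/-- The four types 213, 3123, 2313 and 32123 (the bubbles 1, 2, 3 have the indices 0, 1, 2). -/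
def fourTypes : Set (List (Fin 3)) :=
  {[1, 0, 2], [2, 0, 1, 2], [1, 2, 0, 2], [2, 1, 0, 1, 2]}

/-! In the volume coordinate y = ∫₀ˣ f, volume is length and a boundary point costs g(y) = f(x).
Formally dg/dy = f'/f = (log f)', so log-convexity of f becomes convexity of g
(`convexOn_pointCost`); moreover g is even and strictly increasing on y ≥ 0. Since f ≥ f(0) > 0,
finite perimeter leaves only finitely many boundary points, and a gap between bubbles can be closed
at a strict gain (`cost_close_gap`). A minimizer is therefore a row of adjacent labelled lengths
whose division points have least total cost (`LeastCost`).

Part (a) rests on sliding and exchanging pieces of such a row. If a bubble occurs twice, the stretch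
between its two pieces can slide at no change elsewhere, so it must reach the origin: the left piece
ends at y ≤ 0 and the right one starts at y ≥ 0 (`right_nonpos`, `left_nonneg`). Hence no bubble
occurs three times and no repeated bubble lies entirely beside another; with a few further exchanges
only finitely many words survive, found by enumeration. Volume comparisons then decide which bubble
takes which place (`three_le`, `inner_le_outer`, `straddling_le`, `nested_le`).

For (b), a density equal to 1/cos² x on a long enough interval has y = tan x and g(y) = 1 + y²
there. Least cost is attained by compactness, and for distinct volumes (a) leaves four words up to
reflection. For each word, volumes are chosen for which one explicit row beats lower bounds for the
other three words; these bounds come from replacing the parabola by tangents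
(`exists_leastCost_word`). -/

/-! ### Even convex point costs. -/

/-- Perimeter costs on the line which, in the volume coordinate, come from a symmetric log-convex
density that is uniquely minimized at the origin. -/
structure IsConvexWell (g : ℝ → ℝ) : Prop where
  pos : ∀ x, 0 < g x
  even : ∀ x, g (-x) = g x
  strictMono : StrictMonoOn g (Ici 0)
  convex : ConvexOn ℝ univ g

namespace IsConvexWell

variable {g : ℝ → ℝ}

lemma apply_abs (hg : IsConvexWell g) (x : ℝ) : g |x| = g x := by
  rcases abs_choice x with h | h <;> rw [h]
  exact hg.even x

lemma lt_of_abs_lt (hg : IsConvexWell g) {x y : ℝ} (h : |x| < |y|) : g x < g y := by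
  rw [← hg.apply_abs x, ← hg.apply_abs y]
  exact hg.strictMono (abs_nonneg x) (abs_nonneg y) h

lemma le_of_abs_le (hg : IsConvexWell g) {x y : ℝ} (h : |x| ≤ |y|) : g x ≤ g y := by
  rw [← hg.apply_abs x, ← hg.apply_abs y]
  exact hg.strictMono.monotoneOn (abs_nonneg x) (abs_nonneg y) h

lemma lt_of_abs_lt' (hg : IsConvexWell g) {x y : ℝ} (h₁ : -y < x) (h₂ : x < y) : g x < g y :=
  hg.lt_of_abs_lt ((abs_lt.2 ⟨h₁, h₂⟩).trans_le (le_abs_self y))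

lemma le_of_abs_le' (hg : IsConvexWell g) {x y : ℝ} (h₁ : -y ≤ x) (h₂ : x ≤ y) : g x ≤ g y :=
  hg.le_of_abs_le ((abs_le.2 ⟨h₁, h₂⟩).trans (le_abs_self y))

lemma lt_of_abs_lt_neg (hg : IsConvexWell g) {x y : ℝ} (h₁ : y < x) (h₂ : x < -y) :
    g x < g y := by
  rw [← hg.even y]
  exact hg.lt_of_abs_lt' (by linarith) h₂

lemma le_of_abs_le_neg (hg : IsConvexWell g) {x y : ℝ} (h₁ : y ≤ x) (h₂ : x ≤ -y) :
    g x ≤ g y := by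
  rw [← hg.even y]
  exact hg.le_of_abs_le' (by linarith) h₂

/-- Moving two points towards each other decreases the total cost. -/
lemma add_le_add_of_mem (hg : IsConvexWell g) {a b c d : ℝ} (h : c + d = a + b) (h₁ : a ≤ c)
    (h₂ : c ≤ b) : g c + g d ≤ g a + g b := by
  rcases eq_or_lt_of_le (h₁.trans h₂) with hab | hab
  · have : c = a := le_antisymm (by linarith) h₁
    have : d = b := by linarith
    subst_vars
    exact le_rfl
  · have hba : 0 < b - a := by linarith
    have key : ∀ e, a ≤ e → e ≤ b → g e ≤ (b - e) / (b - a) * g a + (e - a) / (b - a) * g b := by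
      intro e he₁ he₂
      have := hg.convex.2 (mem_univ a) (mem_univ b)
        (div_nonneg (sub_nonneg.2 he₂) hba.le) (div_nonneg (sub_nonneg.2 he₁) hba.le)
        (by field_simp; ring)
      have he : ((b - e) / (b - a)) • a + ((e - a) / (b - a)) • b = e := by
        simp only [smul_eq_mul]; field_simp; ring
      rw [he] at this
      simpa only [smul_eq_mul] using this
    have h₃ := key c h₁ h₂
    have h₄ := key d (by linarith) (by linarith)
    have hd : d = a + b - c := by linarith
    have : (b - c) / (b - a) * g a + (c - a) / (b - a) * g b
        + ((b - d) / (b - a) * g a + (d - a) / (b - a) * g b) = g a + g b := by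
      rw [hd]; field_simp; ring
    linarith

/-- By evenness `g a = g (-a)`, so this is midpoint convexity at `-a` and `b`. Among intervals of a
given length the one centred at the origin has the cheapest endpoints. -/
lemma two_mul_le (hg : IsConvexWell g) (a b : ℝ) :
    2 * g ((b - a) / 2) ≤ g a + g b := by
  rw [← hg.even a]
  rcases le_total (-a) b with h' | h'
  · have := hg.add_le_add_of_mem (a := -a) (b := b) (c := (b - a) / 2) (d := (b - a) / 2)
      (by ring) (by linarith) (by linarith)
    linarith
  · have := hg.add_le_add_of_mem (a := b) (b := -a) (c := (b - a) / 2) (d := (b - a) / 2)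
      (by ring) (by linarith) (by linarith)
    linarith

end IsConvexWell

/-! ### Rows of labelled lengths: length, volumes, cost and translations. -/

section Lists

variable {α : Type*}

/-- Total length of a list of labelled lengths. -/
def len (L : List (α × ℝ)) : ℝ := (L.map Prod.snd).sum

/-- Total length of the pieces labelled `i`. -/
def vol [DecidableEq α] (i : α) : List (α × ℝ) → ℝ
  | [] => 0
  | a :: L => (if a.1 = i then a.2 else 0) + vol i L

/-- Total cost of the division points of a sequence of contiguous intervals starting at `x`. -/
def cost (g : ℝ → ℝ) : ℝ → List (α × ℝ) → ℝ
  | x, [] => g x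
  | x, a :: L => g x + cost g (x + a.2) L

/-- Total cost of the left endpoints of a sequence of contiguous intervals starting at `x`. -/
def leftCost (g : ℝ → ℝ) : ℝ → List (α × ℝ) → ℝ
  | _, [] => 0
  | x, a :: L => g x + leftCost g (x + a.2) L

@[simp] lemma len_nil : len ([] : List (α × ℝ)) = 0 := rfl

@[simp] lemma len_cons (a : α × ℝ) (L : List (α × ℝ)) : len (a :: L) = a.2 + len L := by
  simp [len]

@[simp] lemma len_append (P L : List (α × ℝ)) : len (P ++ L) = len P + len L := by
  simp [len]

@[simp] lemma len_reverse (L : List (α × ℝ)) : len L.reverse = len L := by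
  simp [len, List.sum_reverse]

@[simp] lemma vol_nil [DecidableEq α] (i : α) : vol i [] = 0 := rfl

@[simp] lemma vol_cons [DecidableEq α] (i : α) (a : α × ℝ) (L : List (α × ℝ)) :
    vol i (a :: L) = (if a.1 = i then a.2 else 0) + vol i L := rfl

@[simp] lemma vol_append [DecidableEq α] (i : α) (P L : List (α × ℝ)) :
    vol i (P ++ L) = vol i P + vol i L := by
  induction P with
  | nil => simp
  | cons a P ih => simp [ih, add_assoc]

@[simp] lemma vol_reverse [DecidableEq α] (i : α) (L : List (α × ℝ)) :
    vol i L.reverse = vol i L := by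
  induction L with
  | nil => simp
  | cons a L ih => simp [ih, add_comm]

variable {g : ℝ → ℝ}

@[simp] lemma cost_nil (x : ℝ) : cost g x ([] : List (α × ℝ)) = g x := rfl

@[simp] lemma cost_cons (x : ℝ) (a : α × ℝ) (L : List (α × ℝ)) :
    cost g x (a :: L) = g x + cost g (x + a.2) L := rfl

@[simp] lemma leftCost_nil (x : ℝ) : leftCost g x ([] : List (α × ℝ)) = 0 := rfl

@[simp] lemma leftCost_cons (x : ℝ) (a : α × ℝ) (L : List (α × ℝ)) :
    leftCost g x (a :: L) = g x + leftCost g (x + a.2) L := rfl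

lemma cost_append (x : ℝ) (P L : List (α × ℝ)) :
    cost g x (P ++ L) = leftCost g x P + cost g (x + len P) L := by
  induction P generalizing x with
  | nil => simp
  | cons a P ih => simp [ih, add_assoc]

lemma cost_eq_leftCost (x : ℝ) (P : List (α × ℝ)) :
    cost g x P = leftCost g x P + g (x + len P) := by
  simpa using cost_append (g := g) x P []

/-- The mirror image of a row starts at minus its right end. Every one-sided statement below yields
its mirror image through this. -/
lemma cost_reverse (hg : IsConvexWell g) (x : ℝ) (L : List (α × ℝ)) :
    cost g (-(x + len L)) L.reverse = cost g x L := by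
  induction L generalizing x with
  | nil => simp [hg.even]
  | cons a L ih =>
    have := ih (x + a.2)
    rw [cost_eq_leftCost] at this
    have e₁ : -(x + len (a :: L)) = -(x + a.2 + len L) := by simp; ring
    have e₂ : -(x + a.2 + len L) + len L.reverse = -(x + a.2) := by simp
    have e₃ : -(x + a.2) + a.2 = -x := by ring
    rw [e₂] at this
    rw [List.reverse_cons, cost_append, e₁, e₂, cost_cons, cost_nil, cost_cons, e₃, hg.even x]
    linarith

lemma len_nonneg {L : List (α × ℝ)} (h : ∀ a ∈ L, 0 ≤ a.2) : 0 ≤ len L := by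
  induction L with
  | nil => simp
  | cons a L ih =>
    have h₁ := h a (by simp)
    have h₂ := ih fun b hb => h b (by simp [hb])
    simp; linarith

lemma cost_pos (hg : IsConvexWell g) (x : ℝ) (L : List (α × ℝ)) : 0 < cost g x L := by
  induction L generalizing x with
  | nil => exact hg.pos x
  | cons a L ih => exact add_pos (hg.pos x) (ih _)

/-- Every division point `p ≥ x` satisfies `-p ≤ p - t ≤ p`, so no point gets farther from the
origin. The row may cross the origin, as long as its first point does not pass beyond `-x`. -/
lemma cost_sub_le (hg : IsConvexWell g) {L : List (α × ℝ)} (h : ∀ a ∈ L, 0 ≤ a.2) {x t : ℝ}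
    (ht : 0 ≤ t) (hx : t ≤ 2 * x) : cost g (x - t) L ≤ cost g x L := by
  induction L generalizing x with
  | nil => exact hg.le_of_abs_le' (by linarith) (by linarith)
  | cons a L ih =>
    have h₁ := h a (by simp)
    have h₂ := ih (x := x + a.2) (fun b hb => h b (by simp [hb])) (by linarith)
    have e : x - t + a.2 = x + a.2 - t := by ring
    rw [cost_cons, cost_cons, e]
    exact add_le_add (hg.le_of_abs_le' (by linarith) (by linarith)) h₂

lemma cost_sub_lt (hg : IsConvexWell g) {L : List (α × ℝ)} (h : ∀ a ∈ L, 0 ≤ a.2) {x t : ℝ}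
    (ht : 0 < t) (hx : t < 2 * x) : cost g (x - t) L < cost g x L := by
  cases L with
  | nil => exact hg.lt_of_abs_lt' (by linarith) (by linarith)
  | cons a L =>
    have h₁ := h a (by simp)
    have h₂ := cost_sub_le hg (x := x + a.2) (t := t) (L := L)
      (fun b hb => h b (by simp [hb])) ht.le (by linarith)
    have e : x - t + a.2 = x + a.2 - t := by ring
    rw [cost_cons, cost_cons, e]
    exact add_lt_add_of_lt_of_le (hg.lt_of_abs_lt' (by linarith) (by linarith)) h₂

lemma cost_add_le (hg : IsConvexWell g) {L : List (α × ℝ)} (h : ∀ a ∈ L, 0 ≤ a.2) {x t : ℝ}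
    (ht : 0 ≤ t) (hx : 2 * (x + len L) + t ≤ 0) : cost g (x + t) L ≤ cost g x L := by
  induction L generalizing x with
  | nil => simp at hx; exact hg.le_of_abs_le_neg (by linarith) (by linarith)
  | cons a L ih =>
    have h₁ := h a (by simp)
    have h₃ := len_nonneg fun b hb => h b (List.mem_cons_of_mem a hb)
    rw [len_cons] at hx
    have h₂ := ih (x := x + a.2) (fun b hb => h b (by simp [hb])) (by linarith)
    have e : x + t + a.2 = x + a.2 + t := by ring
    rw [cost_cons, cost_cons, e]
    exact add_le_add (hg.le_of_abs_le_neg (by linarith) (by linarith)) h₂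

lemma exists_append_of_mem_map {L : List (α × ℝ)} {i : α} (hi : i ∈ L.map Prod.fst) : ∃ P a S, L = P ++ (i, a) :: S := by
  obtain ⟨⟨i, a⟩, ha, rfl⟩ := List.mem_map.1 hi
  obtain ⟨P, S, rfl⟩ := List.append_of_mem ha
  exact ⟨P, a, S, rfl⟩

/-! ### Rows of least cost: which words are impossible. -/

/-- A sequence of contiguous labelled intervals of least cost for given volumes. -/
structure LeastCost [DecidableEq α] (g : ℝ → ℝ) (x : ℝ) (L : List (α × ℝ)) : Prop where
  pos : ∀ a ∈ L, 0 < a.2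
  le : ∀ (x' : ℝ) (L' : List (α × ℝ)), (∀ a ∈ L', 0 ≤ a.2) → (∀ i, vol i L' = vol i L) →
    cost g x L ≤ cost g x' L'

namespace LeastCost

variable [DecidableEq α] {x : ℝ} {L P M S : List (α × ℝ)} {i j : α} {a b c d : ℝ}

lemma reverse (hg : IsConvexWell g) (h : LeastCost g x L) : LeastCost g (-(x + len L)) L.reverse where
  pos a ha := h.pos a (by simpa using ha)
  le x' L' h₁ h₂ := by
    rw [cost_reverse hg]
    exact h.le x' L' h₁ fun i => by simpa using h₂ i

lemma nonneg (h : LeastCost g x L) : ∀ a ∈ L, 0 ≤ a.2 := fun a ha => (h.pos a ha).le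

/-- A bubble that occurs again further right ends in the left half line. -/
lemma right_nonpos (hg : IsConvexWell g) (h : LeastCost g x (P ++ (i, a) :: (M ++ (i, b) :: S))) :
    x + len P + a ≤ 0 := by
  by_contra! hu
  have ha : 0 < a := h.pos (i, a) (by simp)
  have hb : 0 < b := h.pos (i, b) (by simp)
  -- The stretch `M` slides left by `t`, the first `i`-piece losing and the second gaining that
  -- length. The bound `t ≤ a` keeps lengths nonnegative, and `t` at most the starting point of `M`
  -- makes the slide a strict gain.
  set t := min a (x + len P + a) with ht
  have ht₀ : 0 < t := lt_min ha hu
  have ht₁ : t ≤ a := min_le_left _ _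
  have ht₂ : t ≤ x + len P + a := min_le_right _ _
  have hlt := cost_sub_lt hg (L := M) (x := x + len P + a)
    (fun c hc => h.nonneg c (by simp [hc])) ht₀ (by linarith)
  have hle := h.le x (P ++ (i, a - t) :: (M ++ (i, b + t) :: S)) (by
    intro c hc
    simp only [List.mem_append, List.mem_cons] at hc
    rcases hc with hc | rfl | hc | rfl | hc
    · exact h.nonneg c (by simp [hc])
    · simpa using ht₁
    · exact h.nonneg c (by simp [hc])
    · exact add_nonneg hb.le ht₀.le
    · exact h.nonneg c (by simp [hc])) (by
    intro l
    simp only [vol_append, vol_cons]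
    split_ifs <;> ring)
  have e₁ : x + len P + (a - t) = x + len P + a - t := by ring
  have e₂ : x + len P + a - t + len M + (b + t) = x + len P + a + len M + b := by ring
  rw [cost_eq_leftCost, cost_eq_leftCost] at hlt
  simp only [cost_append, cost_cons, e₁, e₂] at hle
  linarith

/-- A bubble that occurs already further left starts in the right half line. -/
lemma left_nonneg (hg : IsConvexWell g) (h : LeastCost g x (P ++ (i, a) :: (M ++ (i, b) :: S))) :
    0 ≤ x + len P + a + len M := by
  have h' := h.reverse hg
  have e : (P ++ (i, a) :: (M ++ (i, b) :: S)).reverse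
      = S.reverse ++ (i, b) :: (M.reverse ++ (i, a) :: P.reverse) := by simp
  rw [e] at h'
  have := h'.right_nonpos hg
  simp at this
  linarith

/-- Moving an interval to a later one of the same bubble must not pay off. -/
lemma two_mul_lt (hg : IsConvexWell g)
    (h : LeastCost g x (P ++ (i, a) :: (j, c) :: (M ++ (i, b) :: S))) :
    2 * (x + len P + a + c) < a := by
  by_contra! hu
  have ha : 0 < a := h.pos (i, a) (by simp)
  have hb : 0 < b := h.pos (i, b) (by simp)
  have hc : 0 < c := h.pos (j, c) (by simp)
  -- The first `i`-piece is absorbed by the second: `(j, c)` and `M` slide left by `a` at no extra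
  -- cost, and one division point disappears.
  have hlt := cost_sub_le hg (L := M) (x := x + len P + a + c)
    (fun c hc => h.nonneg c (by simp [hc])) ha.le hu
  have hle := h.le x (P ++ (j, c) :: (M ++ (i, a + b) :: S)) (by
    intro d hd
    simp only [List.mem_append, List.mem_cons] at hd
    rcases hd with hd | rfl | hd | rfl | hd
    · exact h.nonneg d (by simp [hd])
    · exact hc.le
    · exact h.nonneg d (by simp [hd])
    · exact add_nonneg ha.le hb.le
    · exact h.nonneg d (by simp [hd])) (by
    intro l
    simp only [vol_append, vol_cons]
    split_ifs <;> ring)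
  have e₁ : x + len P + a + c - a = x + len P + c := by ring
  have e₂ : x + len P + c + len M + (a + b) = x + len P + a + c + len M + b := by ring
  have := hg.pos (x + len P + a)
  rw [cost_eq_leftCost, cost_eq_leftCost, e₁] at hlt
  simp only [cost_append, cost_cons, e₂] at hle
  linarith

lemma two_mul_lt' (hg : IsConvexWell g)
    (h : LeastCost g x (P ++ (i, a) :: (M ++ (j, c) :: (i, b) :: S))) :
    -2 * (x + len P + a + len M) < b := by
  have h' := h.reverse hg
  have e : (P ++ (i, a) :: (M ++ (j, c) :: (i, b) :: S)).reverse
      = S.reverse ++ (i, b) :: (j, c) :: (M.reverse ++ (i, a) :: P.reverse) := by simp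
  rw [e] at h'
  have := h'.two_mul_lt hg
  simp at this
  linarith

lemma ne_of_adjacent (hg : IsConvexWell g) (h : LeastCost g x (P ++ (i, a) :: (j, b) :: S)) :
    i ≠ j := by
  rintro rfl
  have ha : 0 < a := h.pos (i, a) (by simp)
  have hb : 0 < b := h.pos (i, b) (by simp)
  have hle := h.le x (P ++ (i, a + b) :: S) (by
    intro d hd
    simp only [List.mem_append, List.mem_cons] at hd
    rcases hd with hd | rfl | hd
    · exact h.nonneg d (by simp [hd])
    · exact add_nonneg ha.le hb.le
    · exact h.nonneg d (by simp [hd])) (by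
    intro l
    simp only [vol_append, vol_cons]
    split_ifs <;> ring)
  have := hg.pos (x + len P + a)
  simp only [cost_append, cost_cons, ← add_assoc] at hle
  linarith

/-- Two bubbles do not meet twice in the same order. -/
lemma not_repeat_pair (hg : IsConvexWell g)
    (h : LeastCost g x (P ++ (i, a) :: (j, b) :: (M ++ (i, c) :: (j, d) :: S))) : False := by
  have ha : 0 < a := h.pos (i, a) (by simp)
  have hb : 0 < b := h.pos (j, b) (by simp)
  have hc : 0 < c := h.pos (i, c) (by simp)
  have hd : 0 < d := h.pos (j, d) (by simp)
  have h₁ : x + len (P ++ [(i, a)]) + b ≤ 0 := by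
    refine LeastCost.right_nonpos hg (i := j) (M := M ++ [(i, c)]) (S := S) (b := d) ?_
    simpa using h
  have h₂ : 0 ≤ x + len P + a + len ((j, b) :: M) :=
    LeastCost.left_nonneg hg (i := i) (S := (j, d) :: S) (b := c) (by simpa using h)
  simp only [len_append, len_cons, len_nil, add_zero] at h₁ h₂
  -- The smaller of the two inner pieces `b`, `c` is traded against an equal part of the other and
  -- vanishes. One division point disappears, and one other moves towards the origin by the signs in
  -- `h₁` and `h₂`.
  rcases le_total b c with hbc | hbc
  · have hle := h.le x (P ++ (i, a + b) :: (M ++ (i, c - b) :: (j, d + b) :: S)) (by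
      intro e he
      simp only [List.mem_append, List.mem_cons] at he
      rcases he with he | rfl | he | rfl | rfl | he
      · exact h.nonneg e (by simp [he])
      · exact add_nonneg ha.le hb.le
      · exact h.nonneg e (by simp [he])
      · simpa using hbc
      · exact add_nonneg hd.le hb.le
      · exact h.nonneg e (by simp [he])) (by
      intro l
      simp only [vol_append, vol_cons]
      split_ifs <;> ring)
    have e₁ : x + len P + (a + b) = x + len P + a + b := by ring
    have e₂ : x + len P + a + b + len M + (c - b) + (d + b)
      = x + len P + a + b + len M + c + d := by ring
    have := hg.pos (x + len P + a)
    have := hg.le_of_abs_le' (x := x + len P + a + b + len M + (c - b))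
      (y := x + len P + a + b + len M + c) (by linarith) (by linarith)
    simp only [cost_append, cost_cons, e₁, e₂] at hle
    linarith
  · have hle := h.le x (P ++ (i, a + c) :: (j, b - c) :: (M ++ (j, c + d) :: S)) (by
      intro e he
      simp only [List.mem_append, List.mem_cons] at he
      rcases he with he | rfl | rfl | he | rfl | he
      · exact h.nonneg e (by simp [he])
      · exact add_nonneg ha.le hc.le
      · simpa using hbc
      · exact h.nonneg e (by simp [he])
      · exact add_nonneg hc.le hd.le
      · exact h.nonneg e (by simp [he])) (by
      intro l
      simp only [vol_append, vol_cons]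
      split_ifs <;> ring)
    have e₁ : x + len P + (a + c) + (b - c) = x + len P + a + b := by ring
    have e₂ : x + len P + a + b + len M + (c + d)
      = x + len P + a + b + len M + c + d := by ring
    have := hg.pos (x + len P + a + b + len M + c)
    have := hg.le_of_abs_le_neg (x := x + len P + (a + c)) (y := x + len P + a)
      (by linarith) (by linarith)
    simp only [cost_append, cost_cons, e₁, e₂] at hle
    linarith

/-- A bubble occurs at most twice. -/
lemma not_three (hg : IsConvexWell g) (h : LeastCost g x (P ++ (i, a) :: S))
    (h₁ : i ∈ P.map Prod.fst) (h₂ : i ∈ S.map Prod.fst) : False := by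
  obtain ⟨P₁, b, P₂, rfl⟩ := exists_append_of_mem_map h₁
  obtain ⟨S₁, c, S₂, rfl⟩ := exists_append_of_mem_map h₂
  have ha : 0 < a := h.pos (i, a) (by simp)
  -- The middle piece would end at or left of the origin and start at or right of it, against its
  -- positive length.
  have h₃ := h.right_nonpos hg
  have h₄ := LeastCost.left_nonneg hg (P := P₁) (i := i) (a := b) (M := P₂) (b := a)
    (S := S₁ ++ (i, c) :: S₂) (by simpa using h)
  simp only [len_append, len_cons] at h₃
  linarith

/-- No bubble is repeated to the right of a repeated bubble. -/
lemma not_two_two (hg : IsConvexWell g) {Q : List (α × ℝ)} (h : LeastCost g x (P ++ Q))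
    (h₁ : [i, i].Sublist (P.map Prod.fst)) (h₂ : [j, j].Sublist (Q.map Prod.fst)) : False := by
  have key : ∀ (l : α) (R : List (α × ℝ)), [l, l].Sublist (R.map Prod.fst) →
      ∃ A a B b C, R = A ++ (l, a) :: (B ++ (l, b) :: C) := by
    intro l R hR
    rw [List.cons_sublist_iff] at hR
    obtain ⟨r₁, r₂, hr, h₁, h₂⟩ := hR
    obtain ⟨R₁, R₂, rfl, rfl, rfl⟩ := List.map_eq_append_iff.1 hr
    obtain ⟨A, a, B, rfl⟩ := exists_append_of_mem_map h₁
    obtain ⟨B', b, C, rfl⟩ := exists_append_of_mem_map (List.singleton_sublist.1 h₂)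
    exact ⟨A, a, B ++ B', b, C, by simp⟩
  obtain ⟨A, a, B, b, C, rfl⟩ := key i P h₁
  obtain ⟨A', a', B', b', C', rfl⟩ := key j Q h₂
  have ha : 0 < a' := h.pos (j, a') (by simp)
  have hb : 0 < b := h.pos (i, b) (by simp)
  have hC := len_nonneg (L := C) fun b hb => h.nonneg b (by simp [hb])
  have hA := len_nonneg (L := A') fun b hb => h.nonneg b (by simp [hb])
  -- The second `i`-piece starts at or right of the origin, yet the first `j`-piece, further right,
  -- ends at or left of it.
  have h₃ := LeastCost.left_nonneg hg (P := A) (i := i) (a := a) (M := B) (b := b)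
    (S := C ++ (A' ++ (j, a') :: (B' ++ (j, b') :: C'))) (by simpa using h)
  have h₄ := LeastCost.right_nonpos hg (P := (A ++ (i, a) :: (B ++ (i, b) :: C)) ++ A')
    (i := j) (a := a') (M := B') (b := b') (S := C') (by simpa using h)
  simp only [len_append, len_cons] at h₄
  linarith

/-- Two repeated bubbles do not have adjacent inner intervals. -/
lemma not_adjacent_inner (hg : IsConvexWell g) (h : LeastCost g x (P ++ (j, a) :: (i, b) :: S))
    (h₁ : i ∈ P.map Prod.fst) (h₂ : j ∈ S.map Prod.fst) : False := by
  obtain ⟨P₁, c, P₂, rfl⟩ := exists_append_of_mem_map h₁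
  obtain ⟨S₁, d, S₂, rfl⟩ := exists_append_of_mem_map h₂
  have ha : 0 < a := h.pos (j, a) (by simp)
  have hb : 0 < b := h.pos (i, b) (by simp)
  -- The common endpoint of the two inner pieces must be the origin. Absorbing either piece into its
  -- partner is then unprofitable only if both `2 * b < a` and `2 * a < b`.
  have h₃ := LeastCost.right_nonpos hg (P := P₁ ++ (i, c) :: P₂) (i := j) (a := a)
    (M := (i, b) :: S₁) (b := d) (S := S₂) (by simpa using h)
  have h₄ := LeastCost.left_nonneg hg (P := P₁) (i := i) (a := c) (M := P₂ ++ [(j, a)]) (b := b)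
    (S := S₁ ++ (j, d) :: S₂) (by simpa using h)
  have h₅ := h.two_mul_lt hg
  have h₆ := LeastCost.two_mul_lt' hg (P := P₁) (i := i) (a := c) (M := P₂) (j := j) (c := a) (b := b)
    (S := S₁ ++ (j, d) :: S₂) (by simpa using h)
  simp only [len_append, len_cons, len_nil] at h₃ h₄ h₅
  linarith

end LeastCost

end Lists

/-! ### Volume comparisons in words of three, four and five letters. -/

namespace LeastCost

variable {g : ℝ → ℝ} {α : Type*} [DecidableEq α] {x : ℝ} {i j k : α} {a b c d e : ℝ}

/-- If `a < b`, one of three moves lowers the cost: translating the row when the first inner point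
is right of the origin, exchanging the first two pieces when the middle piece lies mostly to the
left, or bringing the last piece to the front otherwise. -/
lemma three_le (hg : IsConvexWell g) (h : LeastCost g x [(i, a), (j, b), (k, c)]) (hac : a ≤ c) :
    b ≤ a := by
  by_contra! hab
  have ha : 0 < a := h.pos (i, a) (by simp)
  have hb : 0 < b := h.pos (j, b) (by simp)
  have hc : 0 < c := h.pos (k, c) (by simp)
  have hswap : g (x + a) ≤ g (x + b) := by
    have := h.le x [(j, b), (i, a), (k, c)] (by simp; exact ⟨hb.le, ha.le, hc.le⟩)
      (by intro l; simp; ring)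
    simp only [cost_cons, cost_nil] at this
    rw [show x + b + a = x + a + b by ring] at this
    linarith
  rcases lt_or_ge 0 (x + a) with h₁ | h₁
  · set t := min (x + a) (x + a + b + c + x)
    have ht₀ : 0 < t := lt_min h₁ (by linarith)
    have ht₁ : t ≤ x + a := min_le_left _ _
    have ht₂ : t ≤ x + a + b + c + x := min_le_right _ _
    have := h.le (x - t) _ h.nonneg fun _ => rfl
    simp only [cost_cons, cost_nil] at this
    have h₂ := hg.lt_of_abs_lt' (x := x - t + a) (y := x + a) (by linarith) (by linarith)
    have h₃ := hg.lt_of_abs_lt' (x := x - t + a + b) (y := x + a + b) (by linarith) (by linarith)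
    have h₄ := hg.add_le_add_of_mem (a := -x) (b := x + a + b + c) (c := -(x - t))
      (d := x - t + a + b + c) (by ring) (by linarith) (by linarith)
    rw [hg.even, hg.even] at h₄
    linarith
  rcases lt_or_ge (x + a + b) 0 with h₂ | h₂
  · exact absurd hswap (not_le.2 (hg.lt_of_abs_lt_neg (by linarith) (by linarith)))
  rcases le_or_gt (x + a + b) (-(x + a)) with h₃ | h₃
  · exact absurd hswap (not_le.2 (hg.lt_of_abs_lt_neg (by linarith) (by linarith)))
  -- The division point `x + a` stays. After reflecting the left end, the outer ends keep their sum
  -- and move together; this uses `a ≤ c`.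
  · have := h.le (x + a - c) [(k, c), (i, a), (j, b)] (by simp; exact ⟨hc.le, ha.le, hb.le⟩)
      (by intro l; simp; ring)
    simp only [cost_cons, cost_nil, sub_add_cancel] at this
    have h₄ := hg.lt_of_abs_lt' (x := x + a + a) (y := x + a + b) (by linarith) (by linarith)
    have h₅ := hg.add_le_add_of_mem (a := -x) (b := x + a + b + c) (c := -(x + a - c))
      (d := x + a + a + b) (by ring) (by linarith) (by linarith)
    rw [hg.even, hg.even] at h₅
    linarith

/-- If `c > a + d`, bubbles `i` and `k` can change roles: `i` is gathered into one inner piece and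
`k` takes the two outer places. Where the position of the row forbids this, exchanging two
neighbours already gains. The bound for `b` follows by reflection. -/
lemma inner_le_outer (hg : IsConvexWell g) (h : LeastCost g x [(i, a), (j, b), (k, c), (i, d)]) :
    c ≤ a + d := by
  by_contra! hcad
  have ha : 0 < a := h.pos (i, a) (by simp)
  have hb : 0 < b := h.pos (j, b) (by simp)
  have hc : 0 < c := h.pos (k, c) (by simp)
  have hd : 0 < d := h.pos (i, d) (by simp)
  have h₁ : x + a ≤ 0 := by
    simpa using LeastCost.right_nonpos hg (P := []) (M := [(j, b), (k, c)]) (S := []) h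
  have h₃ : 0 ≤ x + a + (b + c) := by
    simpa using LeastCost.left_nonneg hg (P := []) (M := [(j, b), (k, c)]) (S := []) h
  rcases le_or_gt 0 (x + a + b) with h₂ | h₂
  · have := h.le x [(i, a), (j, b), (i, d), (k, c)]
      (by simp; exact ⟨ha.le, hb.le, hd.le, hc.le⟩) (by intro l; simp; ring)
    simp only [cost_cons, cost_nil] at this
    have h₄ := hg.lt_of_abs_lt' (x := x + a + b + d) (y := x + a + b + c)
      (by linarith) (by linarith)
    rw [show x + a + b + d + c = x + a + b + c + d by ring] at this
    linarith
  rcases lt_or_ge a b with hab | hab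
  · have := h.le x [(j, b), (i, a), (k, c), (i, d)]
      (by simp; exact ⟨hb.le, ha.le, hc.le, hd.le⟩) (by intro l; simp; ring)
    simp only [cost_cons, cost_nil] at this
    have h₄ := hg.lt_of_abs_lt_neg (x := x + b) (y := x + a) (by linarith) (by linarith)
    rw [show x + b + a = x + a + b by ring] at this
    linarith
  rcases le_or_gt (-(x + a + b)) (a + d) with h₄ | h₄
  · have := h.le x [(k, a), (j, b), (i, a + d), (k, c - a)]
      (by simp; exact ⟨ha.le, hb.le, by linarith, by linarith⟩)
      (by intro l; simp; split_ifs <;> ring)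
    simp only [cost_cons, cost_nil] at this
    have h₅ := hg.lt_of_abs_lt' (x := x + a + b + (a + d)) (y := x + a + b + c)
      (by linarith) (by linarith)
    rw [show x + a + b + (a + d) + (c - a) = x + a + b + c + d by ring] at this
    linarith
  -- The first length is chosen so that the gathered `i`-piece ends exactly at the origin.
  · have := h.le x [(k, -x - b - a - d), (j, b), (i, a + d), (k, x + a + b + c + d)]
      (by simp; exact ⟨by linarith, hb.le, by linarith, by linarith⟩)
      (by intro l; simp; split_ifs <;> ring)
    simp only [cost_cons, cost_nil] at this
    have h₅ := hg.lt_of_abs_lt_neg (x := x + (-x - b - a - d)) (y := x + a)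
      (by linarith) (by linarith)
    have h₆ := hg.lt_of_abs_lt_neg (x := x + (-x - b - a - d) + b) (y := x + a + b)
      (by linarith) (by linarith)
    have h₇ := hg.le_of_abs_le' (x := x + (-x - b - a - d) + b + (a + d)) (y := x + a + b + c)
      (by linarith) (by linarith)
    rw [show x + (-x - b - a - d) + b + (a + d) + (x + a + b + c + d) = x + a + b + c + d by ring]
      at this
    linarith

/-- Exchanging `j` and `k` gives the first bound; the auxiliary `c ≤ d` ensures that the moved
points do not land too far left. For the second, length is passed from the right `i`-piece to the
left one with `j` fixed, which brings the outer ends together. -/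
lemma straddling_le (hg : IsConvexWell g) (h : LeastCost g x [(i, a), (j, b), (i, c), (k, d)]) :
    b ≤ d ∧ d ≤ a + c := by
  have ha : 0 < a := h.pos (i, a) (by simp)
  have hb : 0 < b := h.pos (j, b) (by simp)
  have hc : 0 < c := h.pos (i, c) (by simp)
  have hd : 0 < d := h.pos (k, d) (by simp)
  have h₁ : x + a ≤ 0 := by
    simpa using LeastCost.right_nonpos hg (P := []) (M := [(j, b)]) (S := [(k, d)]) h
  have h₂ : 0 ≤ x + a + b := by
    simpa using LeastCost.left_nonneg hg (P := []) (M := [(j, b)]) (S := [(k, d)]) h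
  have h₃ : -(2 * (x + a)) < c := by
    simpa using LeastCost.two_mul_lt' hg (P := []) (M := []) (S := [(k, d)]) h
  have hcd : c ≤ d := by
    by_contra! hdc
    have := h.le x [(i, a), (j, b), (k, d), (i, c)]
      (by simp; exact ⟨ha.le, hb.le, hd.le, hc.le⟩) (by intro l; simp; ring)
    simp only [cost_cons, cost_nil] at this
    have h₄ := hg.lt_of_abs_lt' (x := x + a + b + d) (y := x + a + b + c)
      (by linarith) (by linarith)
    rw [show x + a + b + d + c = x + a + b + c + d by ring] at this
    linarith
  constructor
  · by_contra! hdb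
    have := h.le x [(i, a), (k, d), (i, c), (j, b)]
      (by simp; exact ⟨ha.le, hd.le, hc.le, hb.le⟩) (by intro l; simp; ring)
    simp only [cost_cons, cost_nil] at this
    have h₄ := hg.lt_of_abs_lt' (x := x + a + d) (y := x + a + b) (by linarith) (by linarith)
    have h₅ := hg.lt_of_abs_lt' (x := x + a + d + c) (y := x + a + b + c)
      (by linarith) (by linarith)
    rw [show x + a + d + c + b = x + a + b + c + d by ring] at this
    linarith
  · by_contra! hd'
    set t := min c (x + a + b + c + d + x)
    have ht₀ : 0 < t := lt_min hc (by linarith)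
    have ht₁ : t ≤ c := min_le_left _ _
    have ht₂ : t ≤ x + a + b + c + d + x := min_le_right _ _
    have := h.le (x - t) [(i, a + t), (j, b), (i, c - t), (k, d)]
      (by simp; exact ⟨by linarith, hb.le, by linarith, hd.le⟩)
      (by intro l; simp; split_ifs <;> ring)
    simp only [cost_cons, cost_nil] at this
    have h₄ := hg.lt_of_abs_lt' (x := x + a + b + (c - t)) (y := x + a + b + c)
      (by linarith) (by linarith)
    have h₅ := hg.add_le_add_of_mem (a := -x) (b := x + a + b + c + d) (c := -(x - t))
      (d := x + a + b + (c - t) + d) (by ring) (by linarith) (by linarith)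
    rw [show x - t + (a + t) = x + a by ring] at this
    rw [hg.even, hg.even] at h₅
    linarith

/-- The division points form three nested pairs, and each pair costs at least as much as when
centred at the origin. So the row costs no less than the concentric row with the same order, and in
concentric rows smaller volumes belong inside. -/
lemma nested_le (hg : IsConvexWell g)
    (h : LeastCost g x [(i, a), (j, b), (k, c), (j, d), (i, e)]) : c ≤ b + d ∧ b + d ≤ a + e := by
  have ha : 0 < a := h.pos (i, a) (by simp)
  have hb : 0 < b := h.pos (j, b) (by simp)
  have hc : 0 < c := h.pos (k, c) (by simp)
  have hd : 0 < d := h.pos (j, d) (by simp)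
  have he : 0 < e := h.pos (i, e) (by simp)
  have h₁ := hg.two_mul_le x (x + a + b + c + d + e)
  have h₂ := hg.two_mul_le (x + a) (x + a + b + c + d)
  have h₃ := hg.two_mul_le (x + a + b) (x + a + b + c)
  rw [show x + a + b + c + d + e - x = a + b + c + d + e by ring] at h₁
  rw [show x + a + b + c + d - (x + a) = b + c + d by ring] at h₂
  rw [show x + a + b + c - (x + a + b) = c by ring] at h₃
  have key : ∀ (u v w : ℝ) (p q r : α), 0 < u → 0 < v → 0 < w →
      u + v + w = a + b + c + d + e →
      (∀ l, vol l [(r, w / 2), (q, v / 2), (p, u), (q, v / 2), (r, w / 2)]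
        = vol l [(i, a), (j, b), (k, c), (j, d), (i, e)]) →
      g (c / 2) + g ((b + c + d) / 2) ≤ g (u / 2) + g ((u + v) / 2) := by
    intro u v w p q r hu hv hw hs hvol
    have := h.le (-(u + v + w) / 2) [(r, w / 2), (q, v / 2), (p, u), (q, v / 2), (r, w / 2)]
      (by simp; constructorm* _ ∧ _ <;> linarith) hvol
    simp only [cost_cons, cost_nil] at this
    rw [show -(u + v + w) / 2 + w / 2 + v / 2 + u + v / 2 + w / 2 = (u + v + w) / 2 by ring,
      show -(u + v + w) / 2 + w / 2 + v / 2 + u + v / 2 = (u + v) / 2 by ring,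
      show -(u + v + w) / 2 + w / 2 + v / 2 + u = u / 2 by ring,
      show -(u + v + w) / 2 + w / 2 + v / 2 = -(u / 2) by ring,
      show -(u + v + w) / 2 + w / 2 = -((u + v) / 2) by ring,
      show -(u + v + w) / 2 = -((u + v + w) / 2) by ring,
      hg.even, hg.even, hg.even, hs] at this
    linarith
  constructor
  · by_contra! hlt
    have := key (b + d) c (a + e) j k i (by linarith) hc (by linarith) (by ring)
      (by intro l; simp; split_ifs <;> ring)
    rw [show b + d + c = b + c + d by ring] at this
    linarith [hg.lt_of_abs_lt' (x := (b + d) / 2) (y := c / 2) (by linarith) (by linarith)]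
  · by_contra! hlt
    have := key c (a + e) (b + d) k i j hc (by linarith) (by linarith) (by ring)
      (by intro l; simp; split_ifs <;> ring)
    linarith [hg.lt_of_abs_lt' (x := (c + (a + e)) / 2) (y := (b + c + d) / 2)
      (by linarith) (by linarith)]

end LeastCost

/-! ### Enumeration of the admissible words. -/

section Words

set_option maxRecDepth 100000
set_option synthInstance.maxSize 100000
set_option synthInstance.maxHeartbeats 2000000

lemma word_length_four : ∀ a b c d : Fin 3, a ≠ b → b ≠ c → c ≠ d → (∀ i, i ∈ [a, b, c, d]) →
    (a = d ∧ a ≠ b ∧ b ≠ c ∧ a ≠ c) ∨ (a = c ∧ a ≠ b ∧ b ≠ d ∧ a ≠ d) ∨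
    (b = d ∧ a ≠ b ∧ b ≠ c ∧ a ≠ c) := by
  decide

/-- The hypotheses are `not_three`, `not_two_two`, `not_adjacent_inner` at the two inner junctions
and `not_repeat_pair`, read off on letters. -/
lemma word_length_five : ∀ a b c d e : Fin 3, a ≠ b → b ≠ c → c ≠ d → d ≠ e →
    (∀ i, i ∈ [a, b, c, d, e]) → (∀ i, ¬ [i, i, i].Sublist [a, b, c, d, e]) →
    (∀ i j, ¬ [i, i, j, j].Sublist [a, b, c, d, e]) →
    (c ∈ [a] → b ∈ [d, e] → False) → (d ∈ [a, b] → c ∈ [e] → False) →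
    (a = d → b = e → False) →
    a = e ∧ b = d ∧ a ≠ b ∧ b ≠ c ∧ a ≠ c := by
  decide

/-- Without a triple, each letter occurs exactly twice; the prohibition at the central junction is
then enough. -/
lemma word_length_six : ∀ a b c d e f : Fin 3, a ≠ b → b ≠ c → c ≠ d → d ≠ e → e ≠ f →
    (∀ i, ¬ [i, i, i].Sublist [a, b, c, d, e, f]) →
    (∀ i j, ¬ [i, i, j, j].Sublist [a, b, c, d, e, f]) →
    (d ∈ [a, b] → c ∈ [e, f] → False) → False := by
  decide

end Words

namespace LeastCost

variable {g : ℝ → ℝ} {x : ℝ}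

lemma not_triple_sublist {α : Type*} [DecidableEq α] {L : List (α × ℝ)} (hg : IsConvexWell g)
    (h : LeastCost g x L) (i : α) : ¬ [i, i, i].Sublist (L.map Prod.fst) := by
  intro hs
  obtain ⟨r₁, r₂, hr, h₁, h₂⟩ := List.cons_sublist_iff.1 hs
  obtain ⟨P, Q, rfl, rfl, rfl⟩ := List.map_eq_append_iff.1 hr
  obtain ⟨r₃, r₄, hr', h₃, h₄⟩ := List.cons_sublist_iff.1 h₂
  obtain ⟨R, S, rfl, rfl, rfl⟩ := List.map_eq_append_iff.1 hr'
  obtain ⟨A, a, B, rfl⟩ := exists_append_of_mem_map h₃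
  refine LeastCost.not_three hg (P := P ++ A) (i := i) (a := a) (S := B ++ S)
    (by simpa using h) ?_ ?_
  · rw [List.map_append]
    exact List.mem_append_left _ h₁
  · rw [List.map_append]
    exact List.mem_append_right _ (List.singleton_sublist.1 h₄)

lemma not_double_double_sublist {α : Type*} [DecidableEq α] {L : List (α × ℝ)}
    (hg : IsConvexWell g) (h : LeastCost g x L) (i j : α) :
    ¬ [i, i, j, j].Sublist (L.map Prod.fst) := by
  intro hs
  obtain ⟨r₁, r₂, hr, h₁, h₂⟩ := List.append_sublist_iff.1 (show ([i, i] ++ [j, j]).Sublist _ from hs)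
  obtain ⟨P, Q, rfl, rfl, rfl⟩ := List.map_eq_append_iff.1 hr
  exact h.not_two_two hg h₁ h₂

lemma length_le_six {L : List (Fin 3 × ℝ)} (hg : IsConvexWell g) (h : LeastCost g x L) :
    L.length ≤ 6 := by
  have hc : ∀ i, (L.map Prod.fst).count i ≤ 2 := by
    intro i
    by_contra! hlt
    exact h.not_triple_sublist hg i (List.replicate_sublist_iff (n := 3).2 hlt)
  have hsum : ∀ w : List (Fin 3), w.length = w.count 0 + w.count 1 + w.count 2 := by
    intro w
    induction w with
    | nil => rfl
    | cons a w ih =>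
      fin_cases a <;> simp [ih] <;> omega
  have := hsum (L.map Prod.fst)
  rw [List.length_map] at this
  have := hc 0
  have := hc 1
  have := hc 2
  omega

lemma vol_eq_zero_of_notMem {α : Type*} [DecidableEq α] {i : α} {L : List (α × ℝ)}
    (h : i ∉ L.map Prod.fst) : vol i L = 0 := by
  induction L with
  | nil => rfl
  | cons a L ih =>
    simp only [List.map_cons, List.mem_cons, not_or] at h
    rw [vol_cons, ih h.2, if_neg (Ne.symm h.1), add_zero]

/-- The words of the bubbles of volumes `V i ≤ V j ≤ V k` in the order given by one of the four
types or its reversal. -/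
def IsMinimalWord (V : Fin 3 → ℝ) (w : List (Fin 3)) : Prop :=
  ∃ i j k : Fin 3, i ≠ j ∧ j ≠ k ∧ i ≠ k ∧ V i ≤ V j ∧ V j ≤ V k ∧
    (w = [j, i, k] ∨ w = [k, i, j] ∨ w = [k, i, j, k] ∨ w = [k, j, i, k] ∨
      w = [j, k, i, k] ∨ w = [k, i, k, j] ∨ w = [k, j, i, j, k])

theorem isMinimalWord {L : List (Fin 3 × ℝ)} (hg : IsConvexWell g) (h : LeastCost g x L)
    (hpos : ∀ i, 0 < vol i L) : IsMinimalWord (fun i => vol i L) (L.map Prod.fst) := by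
  have hmem : ∀ i, i ∈ L.map Prod.fst := by
    intro i
    by_contra hi
    exact (hpos i).ne' (vol_eq_zero_of_notMem hi)
  have hl := h.length_le_six hg
  have h₃ := h.not_triple_sublist hg
  have h₄ := h.not_double_double_sublist hg
  have hr := h.reverse hg
  match L with
  | [] => simp at hmem
  | [(i, _)] =>
    have := (by decide : ∀ i : Fin 3, ¬ ∀ l, l ∈ [i]) i
    exact absurd hmem this
  | [(i, _), (j, _)] =>
    have := (by decide : ∀ i j : Fin 3, ¬ ∀ l, l ∈ [i, j]) i j
    exact absurd hmem this
  | [(i, a), (j, b), (k, c)] =>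
    have hd : i ≠ j ∧ j ≠ k ∧ i ≠ k := by
      have := (by decide : ∀ i j k : Fin 3, (∀ l, l ∈ [i, j, k]) → i ≠ j ∧ j ≠ k ∧ i ≠ k) i j k
      exact this hmem
    obtain ⟨hij, hjk, hik⟩ := hd
    have hv : vol i [(i, a), (j, b), (k, c)] = a ∧ vol j [(i, a), (j, b), (k, c)] = b ∧
      vol k [(i, a), (j, b), (k, c)] = c := by
      simp [hij, hjk, hik, hij.symm, hjk.symm, hik.symm]
    rcases le_total a c with hac | hac
    · refine ⟨j, i, k, hij.symm, hik, hjk, ?_⟩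
      simp only [hv]
      exact ⟨h.three_le hg hac, hac, by simp⟩
    · refine ⟨j, k, i, hjk, hik.symm, hij.symm, ?_⟩
      simp only [hv]
      exact ⟨LeastCost.three_le hg (by simpa using hr) hac, hac, by simp⟩
  | [(i, a), (j, b), (k, c), (l, d)] =>
    rcases word_length_four i j k l (h.ne_of_adjacent hg (P := []))
      (LeastCost.ne_of_adjacent hg (P := [(i, a)]) h)
      (LeastCost.ne_of_adjacent hg (P := [(i, a), (j, b)]) h) hmem with
      ⟨rfl, hij, hjk, hik⟩ | ⟨rfl, hij, hjk, hik⟩ | ⟨rfl, hij, hjk, hik⟩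
    · have hv : vol i [(i, a), (j, b), (k, c), (i, d)] = a + d ∧
        vol j [(i, a), (j, b), (k, c), (i, d)] = b ∧
        vol k [(i, a), (j, b), (k, c), (i, d)] = c := by
        simp [hij, hjk, hik, hij.symm, hjk.symm, hik.symm]
      have h₅ := h.inner_le_outer hg
      have h₆ := LeastCost.inner_le_outer hg (i := i) (a := d) (j := k) (b := c) (k := j) (c := b)
        (d := a) (by simpa using hr)
      rcases le_total b c with hbc | hbc
      · refine ⟨j, k, i, hjk, hik.symm, hij.symm, ?_⟩
        simp only [hv]
        exact ⟨hbc, h₅, by simp⟩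
      · refine ⟨k, j, i, hjk.symm, hij.symm, hik.symm, ?_⟩
        simp only [hv]
        exact ⟨hbc, by linarith, by simp⟩
    · have hv : vol i [(i, a), (j, b), (i, c), (l, d)] = a + c ∧
        vol j [(i, a), (j, b), (i, c), (l, d)] = b ∧
        vol l [(i, a), (j, b), (i, c), (l, d)] = d := by
        simp [hij, hjk, hik, hij.symm, hjk.symm, hik.symm]
      have h₅ := h.straddling_le hg
      refine ⟨j, l, i, hjk, hik.symm, hij.symm, ?_⟩
      simp only [hv]
      exact ⟨h₅.1, h₅.2, by simp⟩
    · have hv : vol j [(i, a), (j, b), (k, c), (j, d)] = b + d ∧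
        vol i [(i, a), (j, b), (k, c), (j, d)] = a ∧
        vol k [(i, a), (j, b), (k, c), (j, d)] = c := by
        simp [hij, hjk, hik, hij.symm, hjk.symm, hik.symm]
      have h₅ := LeastCost.straddling_le hg (i := j) (a := d) (j := k) (b := c) (c := b) (k := i)
        (d := a) (by simpa using hr)
      refine ⟨k, i, j, hik.symm, hij, hjk.symm, ?_⟩
      simp only [hv]
      exact ⟨h₅.1, by linarith, by simp⟩
  | [(i, a), (j, b), (k, c), (l, d), (m, e)] =>
    obtain ⟨rfl, rfl, hij, hjk, hik⟩ := word_length_five i j k l m (h.ne_of_adjacent hg (P := []))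
      (LeastCost.ne_of_adjacent hg (P := [(i, a)]) h)
      (LeastCost.ne_of_adjacent hg (P := [(i, a), (j, b)]) h)
      (LeastCost.ne_of_adjacent hg (P := [(i, a), (j, b), (k, c)]) h) hmem h₃ h₄
      (LeastCost.not_adjacent_inner hg (P := [(i, a)]) h)
      (LeastCost.not_adjacent_inner hg (P := [(i, a), (j, b)]) h)
      (by rintro rfl rfl
          exact LeastCost.not_repeat_pair hg (P := []) (M := [(k, c)]) (S := []) h)
    have hv : vol i [(i, a), (j, b), (k, c), (j, d), (i, e)] = a + e ∧
      vol j [(i, a), (j, b), (k, c), (j, d), (i, e)] = b + d ∧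
      vol k [(i, a), (j, b), (k, c), (j, d), (i, e)] = c := by
      simp [hij, hjk, hik, hij.symm, hjk.symm, hik.symm]
    have h₅ := h.nested_le hg
    refine ⟨k, j, i, hjk.symm, hij.symm, hik.symm, ?_⟩
    simp only [hv]
    exact ⟨h₅.1, h₅.2, by simp⟩
  | [(i, a), (j, b), (k, c), (l, d), (m, e), (n, f)] =>
    exact (word_length_six i j k l m n (h.ne_of_adjacent hg (P := []))
      (LeastCost.ne_of_adjacent hg (P := [(i, a)]) h)
      (LeastCost.ne_of_adjacent hg (P := [(i, a), (j, b)]) h)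
      (LeastCost.ne_of_adjacent hg (P := [(i, a), (j, b), (k, c)]) h)
      (LeastCost.ne_of_adjacent hg (P := [(i, a), (j, b), (k, c), (l, d)]) h) h₃ h₄
      (LeastCost.not_adjacent_inner hg (P := [(i, a), (j, b)]) h)).elim
  | _ :: _ :: _ :: _ :: _ :: _ :: _ :: _ => simp at hl; omega

end LeastCost

/-! ### From a log-convex density to a convex cost in the volume coordinate. -/

/-- A symmetric log-convex density that is uniquely minimized at the origin. -/
structure IsSymmLogConvex (f : ℝ → ℝ) : Prop where
  pos : ∀ x, 0 < f x
  even : ∀ x, f (-x) = f x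
  convex : ConvexOn ℝ univ fun x => Real.log (f x)
  lt : ∀ x, x ≠ 0 → f 0 < f x

/-- Formally `f' = (log f)' f ≥ m f`, integrated. To avoid derivatives of `f`, it is compared with
an exponential of rate `m`, whose integral is explicit. -/
lemma mul_integral_le_sub {f : ℝ → ℝ} (hc : Continuous f) (hpos : ∀ x, 0 < f x) {m q x : ℝ}
    (hqx : q ≤ x) (h : ∀ y z, q ≤ y → y ≤ z → m * (z - y) ≤ Real.log (f z) - Real.log (f y)) :
    m * ∫ t in q..x, f t ≤ f x - f q := by
  have hexp : ∀ y z, q ≤ y → y ≤ z → f y * Real.exp (m * (z - y)) ≤ f z := by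
    intro y z hy hz
    rw [← Real.exp_log (hpos y), ← Real.exp_add, ← Real.le_log_iff_exp_le (hpos z)]
    linarith [h y z hy hz]
  have key : ∀ c s : ℝ, (∀ t ∈ Icc q x, m * f t ≤ m * (c * Real.exp (m * (t - s)))) →
      m * ∫ t in q..x, f t ≤ c * Real.exp (m * (x - s)) - c * Real.exp (m * (q - s)) := by
    intro c s hcs
    rw [← intervalIntegral.integral_const_mul]
    calc ∫ t in q..x, m * f t ≤ ∫ t in q..x, m * (c * Real.exp (m * (t - s))) :=
          intervalIntegral.integral_mono_on hqx
            ((continuous_const.mul hc).intervalIntegrable _ _)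
            (Continuous.intervalIntegrable (by fun_prop) _ _) hcs
      _ = _ := by
          refine intervalIntegral.integral_eq_sub_of_hasDerivAt
            (f := fun t => c * Real.exp (m * (t - s))) (fun t _ => ?_)
            (Continuous.intervalIntegrable (by fun_prop) _ _)
          have h₁ : HasDerivAt (fun t => m * (t - s)) m t := by
            simpa using ((hasDerivAt_id t).sub_const s).const_mul m
          have := (h₁.exp).const_mul c
          exact this.congr_deriv (by ring)
  have hqx' := hexp q x le_rfl hqx
  -- For `m ≥ 0` an upper bound on `f` is needed, given by the exponential through `(x, f x)`; for
  -- `m ≤ 0` a lower bound, given by the one through `(q, f q)`.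
  rcases le_total 0 m with hm | hm
  · have := key (f x) x fun t ht => mul_le_mul_of_nonneg_left (by
      have := hexp t x ht.1 ht.2
      rw [show m * (t - x) = -(m * (x - t)) by ring, Real.exp_neg, ← div_eq_mul_inv,
        le_div_iff₀ (Real.exp_pos _)]
      exact this) hm
    rw [sub_self, mul_zero, Real.exp_zero, mul_one] at this
    refine this.trans ?_
    have : f q ≤ f x * Real.exp (m * (q - x)) := by
      rw [show m * (q - x) = -(m * (x - q)) by ring, Real.exp_neg, ← div_eq_mul_inv,
        le_div_iff₀ (Real.exp_pos _)]
      exact hqx'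
    linarith
  · have := key (f q) q fun t ht => mul_le_mul_of_nonpos_left (hexp q t le_rfl ht.1) hm
    rw [sub_self, mul_zero, Real.exp_zero, mul_one] at this
    linarith

namespace IsSymmLogConvex

variable {f : ℝ → ℝ}

lemma continuous (hf : IsSymmLogConvex f) : Continuous f := by
  have h : Continuous fun x => Real.log (f x) :=
    continuousOn_univ.1 (hf.convex.continuousOn isOpen_univ)
  have : f = fun x => Real.exp (Real.log (f x)) := by
    ext x
    rw [Real.exp_log (hf.pos x)]
  rw [this]
  exact Real.continuous_exp.comp h

lemma zero_le (hf : IsSymmLogConvex f) (x : ℝ) : f 0 ≤ f x := by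
  rcases eq_or_ne x 0 with rfl | h
  · exact le_rfl
  · exact (hf.lt x h).le

lemma strictMonoOn (hf : IsSymmLogConvex f) : StrictMonoOn f (Ici 0) := by
  intro x hx y hy hxy
  rcases eq_or_lt_of_le (mem_Ici.1 hx) with rfl | hx
  · exact hf.lt y hxy.ne'
  have hy : 0 < y := hx.trans hxy
  have h := hf.convex.2 (mem_univ 0) (mem_univ y) (show 0 ≤ 1 - x / y from
    sub_nonneg.2 ((div_le_one hy).2 hxy.le)) (show 0 ≤ x / y by positivity) (by ring)
  have e : (1 - x / y) • (0 : ℝ) + (x / y) • y = x := by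
    simp only [smul_eq_mul]; field_simp; ring
  rw [e] at h
  simp only [smul_eq_mul] at h
  have hlog : Real.log (f 0) < Real.log (f y) := Real.log_lt_log (hf.pos 0) (hf.lt y hy.ne')
  have hxy' : 0 < 1 - x / y := sub_pos.2 ((div_lt_one hy).2 hxy)
  rw [← Real.log_lt_log_iff (hf.pos x) (hf.pos y)]
  nlinarith

lemma intervalIntegrable (hf : IsSymmLogConvex f) (a b : ℝ) :
    IntervalIntegrable f volume a b := hf.continuous.intervalIntegrable a b

lemma integral_sub (hf : IsSymmLogConvex f) (x y : ℝ) :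
    (∫ t in 0..y, f t) - ∫ t in 0..x, f t = ∫ t in x..y, f t :=
  intervalIntegral.integral_interval_sub_left (hf.intervalIntegrable _ _)
    (hf.intervalIntegrable _ _)

lemma mul_sub_le_integral (hf : IsSymmLogConvex f) {x y : ℝ} (h : x ≤ y) :
    f 0 * (y - x) ≤ ∫ t in x..y, f t := by
  have := intervalIntegral.integral_mono_on h (f := fun _ => f 0) (by simp)
    (hf.intervalIntegrable x y) fun t _ => hf.zero_le t
  simpa [mul_comm] using this

lemma strictMono_integral (hf : IsSymmLogConvex f) : StrictMono fun x => ∫ t in 0..x, f t := by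
  intro x y hxy
  have h₁ := hf.mul_sub_le_integral hxy.le
  have h₂ := hf.integral_sub x y
  have h₃ : 0 < f 0 * (y - x) := mul_pos (hf.pos 0) (sub_pos.2 hxy)
  simp only
  linarith

lemma continuous_integral (hf : IsSymmLogConvex f) : Continuous fun x => ∫ t in 0..x, f t :=
  intervalIntegral.continuous_primitive hf.intervalIntegrable 0

lemma integral_neg (hf : IsSymmLogConvex f) (x : ℝ) :
    ∫ t in 0..-x, f t = -∫ t in 0..x, f t := by
  have := intervalIntegral.integral_comp_neg (a := 0) (b := x) f
  simp only [hf.even, neg_zero] at this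
  rw [this, intervalIntegral.integral_symm]

lemma surjective_integral (hf : IsSymmLogConvex f) :
    Function.Surjective fun x => ∫ t in 0..x, f t := by
  have hpos : ∀ y, 0 ≤ y → ∃ x, 0 ≤ x ∧ ∫ t in 0..x, f t = y := by
    intro y hy
    have hx : 0 ≤ y / f 0 := div_nonneg hy (hf.pos 0).le
    have h₁ := hf.mul_sub_le_integral hx
    rw [sub_zero, mul_div_cancel₀ _ (hf.pos 0).ne'] at h₁
    obtain ⟨x, hx, h⟩ := intermediate_value_Icc hx hf.continuous_integral.continuousOn
      (show y ∈ Icc _ _ from ⟨by simpa using hy, h₁⟩)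
    exact ⟨x, hx.1, h⟩
  intro y
  rcases le_total 0 y with hy | hy
  · obtain ⟨x, -, h⟩ := hpos y hy
    exact ⟨x, h⟩
  · obtain ⟨x, -, h⟩ := hpos (-y) (by linarith)
    refine ⟨-x, ?_⟩
    simp only [hf.integral_neg, h, neg_neg]

/-- The volume coordinate of a density: the weighted volume to the right of the origin. -/
noncomputable def volumeCoord (hf : IsSymmLogConvex f) : ℝ ≃o ℝ :=
  hf.strictMono_integral.orderIsoOfSurjective _ hf.surjective_integral

lemma volumeCoord_apply (hf : IsSymmLogConvex f) (x : ℝ) :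
    hf.volumeCoord x = ∫ t in 0..x, f t := rfl

/-- The density as a function of the volume coordinate. -/
noncomputable def pointCost (hf : IsSymmLogConvex f) (y : ℝ) : ℝ := f (hf.volumeCoord.symm y)

@[simp] lemma pointCost_volumeCoord (hf : IsSymmLogConvex f) (x : ℝ) :
    hf.pointCost (hf.volumeCoord x) = f x := by simp [pointCost]

lemma exists_slope (hf : IsSymmLogConvex f) (q : ℝ) : ∃ m : ℝ,
    (∀ y z, q ≤ y → y ≤ z → m * (z - y) ≤ Real.log (f z) - Real.log (f y)) ∧
    ∀ y z, z ≤ q → y ≤ z → Real.log (f z) - Real.log (f y) ≤ m * (z - y) := by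
  set φ := fun x => Real.log (f x) with hφ
  have hi : ∀ x : ℝ, x ∈ interior (univ : Set ℝ) := by simp
  refine ⟨derivWithin φ (Ioi q) q, ?_, ?_⟩
  · intro y z hy hz
    rcases eq_or_lt_of_le hz with rfl | hz
    · simp
    have h₁ := hf.convex.rightDeriv_le_slope_of_mem_interior (hi y) (mem_univ z) hz
    have h₂ := hf.convex.monotoneOn_rightDeriv (hi q) (hi y) hy
    have h₃ := h₂.trans h₁
    rw [slope_def_field, le_div_iff₀ (sub_pos.2 hz)] at h₃
    exact h₃
  · intro y z hz hy
    rcases eq_or_lt_of_le hy with rfl | hy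
    · simp
    have h₁ := hf.convex.slope_le_leftDeriv_of_mem_interior (mem_univ y) (hi z) hy
    have h₂ := hf.convex.leftDeriv_le_rightDeriv_of_mem_interior (hi z)
    have h₃ := hf.convex.monotoneOn_rightDeriv (hi z) (hi q) hz
    have h₄ := (h₁.trans h₂).trans h₃
    rw [slope_def_field, div_le_iff₀ (sub_pos.2 hy)] at h₄
    exact h₄

/-- The slope of `f` against volume is the slope of `log f` against position. A subgradient of `log
f` at `q` therefore supports `f` in the volume coordinate; points left of `q` are handled by
reflection, with slope `-m`. -/
lemma exists_supporting_line (hf : IsSymmLogConvex f) (q : ℝ) :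
    ∃ m : ℝ, ∀ x, f q + m * (hf.volumeCoord x - hf.volumeCoord q) ≤ f x := by
  obtain ⟨m, h₁, h₂⟩ := hf.exists_slope q
  refine ⟨m, fun x => ?_⟩
  rw [volumeCoord_apply, volumeCoord_apply, hf.integral_sub]
  rcases le_total q x with hqx | hqx
  · linarith [mul_integral_le_sub hf.continuous hf.pos hqx h₁]
  · have := mul_integral_le_sub hf.continuous hf.pos (m := -m) (q := -q) (x := -x)
      (by linarith) (by
        intro y z hy hz
        have := h₂ (-z) (-y) (by linarith) (by linarith)
        rw [hf.even, hf.even] at this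
        linarith)
    have e := intervalIntegral.integral_comp_neg (a := x) (b := q) f
    simp only [hf.even] at e this
    rw [← e, intervalIntegral.integral_symm] at this
    linarith [this]

lemma convexOn_pointCost (hf : IsSymmLogConvex f) : ConvexOn ℝ univ hf.pointCost := by
  refine ⟨convex_univ, fun x _ y _ a b ha hb hab => ?_⟩
  obtain ⟨m, hm⟩ := hf.exists_supporting_line (hf.volumeCoord.symm (a • x + b • y))
  have h₁ := hm (hf.volumeCoord.symm x)
  have h₂ := hm (hf.volumeCoord.symm y)
  simp only [OrderIso.apply_symm_apply, smul_eq_mul] at h₁ h₂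
  simp only [pointCost, smul_eq_mul]
  set c := f (hf.volumeCoord.symm (a * x + b * y))
  have h₃ := mul_le_mul_of_nonneg_left h₁ ha
  have h₄ := mul_le_mul_of_nonneg_left h₂ hb
  have h₅ : a * (c + m * (x - (a * x + b * y))) + b * (c + m * (y - (a * x + b * y)))
      = (a + b) * c + m * ((a * x + b * y) - (a + b) * (a * x + b * y)) := by ring
  rw [hab] at h₅
  linarith

lemma isConvexWell (hf : IsSymmLogConvex f) : IsConvexWell hf.pointCost where
  pos y := hf.pos _
  even y := by
    obtain ⟨x, rfl⟩ := hf.volumeCoord.surjective y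
    have : -hf.volumeCoord x = hf.volumeCoord (-x) := by
      rw [volumeCoord_apply, volumeCoord_apply, hf.integral_neg]
    rw [this, pointCost_volumeCoord, pointCost_volumeCoord, hf.even]
  strictMono := by
    have h0 : hf.volumeCoord.symm 0 = 0 := by
      rw [OrderIso.symm_apply_eq, volumeCoord_apply, intervalIntegral.integral_same]
    intro x hx y hy hxy
    refine hf.strictMonoOn ?_ ?_ (hf.volumeCoord.symm.strictMono hxy)
    · rw [mem_Ici, ← h0]; exact hf.volumeCoord.symm.monotone hx
    · rw [mem_Ici, ← h0]; exact hf.volumeCoord.symm.monotone hy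
  convex := hf.convexOn_pointCost

end IsSymmLogConvex

/-! ### Closing the gaps between bubbles. -/

section Gaps

variable {α : Type*} [DecidableEq α] {g : ℝ → ℝ}

omit [DecidableEq α] in
/-- Gaps between the bubbles can be closed, which strictly lowers the cost. -/
lemma cost_close_gap (hg : IsConvexWell g) {x a : ℝ} {P S : List (Option α × ℝ)}
    (h : ∀ b ∈ P ++ (none, a) :: S, 0 ≤ b.2) :
    ∃ x', cost g x' (P ++ S) < cost g x (P ++ (none, a) :: S) := by
  have hP : ∀ b ∈ P, 0 ≤ b.2 := fun b hb => h b (by simp [hb])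
  have hS : ∀ b ∈ S, 0 ≤ b.2 := fun b hb => h b (by simp [hb])
  have ha : 0 ≤ a := h (none, a) (by simp)
  -- A gap right of the origin is closed by sliding `S` left, one left of it by sliding `P` right;
  -- if the gap straddles the origin, both sides slide until they meet there. In each case one
  -- division point is saved.
  rcases le_or_gt 0 (x + len P) with h₁ | h₁
  · refine ⟨x, ?_⟩
    have h₂ := cost_sub_le hg hS (x := x + len P + a) ha (by linarith)
    have h₃ := hg.pos (x + len P)
    rw [add_sub_cancel_right] at h₂
    simp only [cost_append, cost_cons]
    linarith
  rcases le_or_gt (x + len P + a) 0 with h₂ | h₂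
  · refine ⟨x + a, ?_⟩
    have h₃ := cost_add_le hg hP (x := x) ha (by linarith)
    have h₄ := hg.pos (x + a + len P)
    rw [cost_eq_leftCost, cost_eq_leftCost] at h₃
    simp only [cost_append, cost_cons]
    rw [show x + a + len P = x + len P + a by ring] at h₃ h₄ ⊢
    linarith
  · refine ⟨-len P, ?_⟩
    have h₃ := cost_add_le hg hP (x := x) (t := -(x + len P)) (by linarith) (by linarith)
    have h₄ := cost_sub_le hg hS (x := x + len P + a) (t := x + len P + a) h₂.le (by linarith)
    have h₅ := hg.pos 0
    rw [cost_eq_leftCost, cost_eq_leftCost, show x + -(x + len P) = -len P by ring,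
      neg_add_cancel] at h₃
    rw [sub_self] at h₄
    simp only [cost_append, cost_cons, neg_add_cancel]
    linarith

/-- Labelled lengths without gaps, as a special case of those with gaps. -/
def withGaps (L : List (α × ℝ)) : List (Option α × ℝ) := L.map fun a => (some a.1, a.2)

omit [DecidableEq α] in
lemma cost_withGaps (x : ℝ) (L : List (α × ℝ)) : cost g x (withGaps L) = cost g x L := by
  induction L generalizing x with
  | nil => rfl
  | cons a L ih => simp only [withGaps, List.map_cons, cost_cons] at ih ⊢; rw [ih]

lemma vol_withGaps (i : α) (L : List (α × ℝ)) : vol (some i) (withGaps L) = vol i L := by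
  induction L with
  | nil => rfl
  | cons a L ih => simp only [withGaps, List.map_cons, vol_cons, Option.some.injEq] at ih ⊢; rw [ih]

/-- Gaps are closed one at a time, by recursion on the length. The strict inequality is what rules
out gaps in a minimizer. -/
lemma exists_withGaps (hg : IsConvexWell g) (x : ℝ) (L : List (Option α × ℝ))
    (h : ∀ b ∈ L, 0 ≤ b.2) :
    (∃ L', L = withGaps L') ∨ ∃ x' L', (∀ b ∈ L', 0 ≤ b.2) ∧
      (∀ i : α, vol i L' = vol (some i) L) ∧ cost g x' L' < cost g x L := by
  by_cases hn : none ∈ L.map Prod.fst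
  · right
    obtain ⟨P, a, S, rfl⟩ := exists_append_of_mem_map hn
    obtain ⟨x', hx'⟩ := cost_close_gap (x := x) hg h
    have hPS : ∀ b ∈ P ++ S, 0 ≤ b.2 := by
      intro b hb
      apply h
      simp only [List.mem_append, List.mem_cons] at hb ⊢
      tauto
    have hv : ∀ i : α, vol (some i) (P ++ S) = vol (some i) (P ++ (none, a) :: S) := by
      intro i; simp
    rcases exists_withGaps hg x' (P ++ S) hPS with ⟨L', hL'⟩ | ⟨x'', L', h₁, h₂, h₃⟩
    · rw [hL'] at hPS hv hx'
      refine ⟨x', L', fun b hb => hPS (some b.1, b.2) (List.mem_map_of_mem hb), fun i => ?_, ?_⟩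
      · rw [← hv, vol_withGaps]
      · rwa [cost_withGaps] at hx'
    · exact ⟨x'', L', h₁, fun i => (h₂ i).trans (hv i), h₃.trans hx'⟩
  · left
    clear h
    induction L with
    | nil => exact ⟨[], rfl⟩
    | cons a L ih =>
      simp only [List.map_cons, List.mem_cons, not_or] at hn
      obtain ⟨L', rfl⟩ := ih hn.2
      obtain ⟨i, hi⟩ := Option.ne_none_iff_exists'.1 (Ne.symm hn.1)
      exact ⟨(i, a.2) :: L', by simp [withGaps, ← hi]⟩
termination_by L.length

end Gaps

/-! ### Regions of a row: disjointness, boundary, volume and perimeter. -/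

section Regions

variable {α : Type*} [DecidableEq α] {u : ℝ → ℝ}

/-- The region labelled `i` of contiguous labelled intervals, whose endpoints are the images under
`u` of the division points. -/
def region (u : ℝ → ℝ) : ℝ → List (α × ℝ) → α → Set ℝ
  | _, [], _ => ∅
  | x, a :: L, i => (if a.1 = i then Icc (u x) (u (x + a.2)) else ∅) ∪ region u (x + a.2) L i

@[simp] lemma region_nil (x : ℝ) (i : α) : region u x [] i = ∅ := rfl

lemma region_cons (x : ℝ) (a : α × ℝ) (L : List (α × ℝ)) (i : α) :
    region u x (a :: L) i
      = (if a.1 = i then Icc (u x) (u (x + a.2)) else ∅) ∪ region u (x + a.2) L i := rfl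

lemma region_withGaps (x : ℝ) (L : List (α × ℝ)) (i : α) :
    region u x (withGaps L) (some i) = region u x L i := by
  induction L generalizing x with
  | nil => rfl
  | cons a L ih =>
    simp only [withGaps, List.map_cons, region_cons, Option.some.injEq] at ih ⊢; rw [ih]

lemma region_map {β : Type*} [DecidableEq β] (e : α ≃ β) (x : ℝ) (L : List (α × ℝ)) (i : α) :
    region u x (L.map fun a => (e a.1, a.2)) (e i) = region u x L i := by
  induction L generalizing x with
  | nil => rfl
  | cons a L ih => simp only [List.map_cons, region_cons, e.apply_eq_iff_eq, ih]

lemma measurableSet_region (x : ℝ) (L : List (α × ℝ)) (i : α) :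
    MeasurableSet (region u x L i) := by
  induction L generalizing x with
  | nil => exact MeasurableSet.empty
  | cons a L ih =>
    rw [region_cons]
    refine MeasurableSet.union ?_ (ih _)
    split_ifs
    · exact measurableSet_Icc
    · exact MeasurableSet.empty

lemma region_subset_Ici (hu : Monotone u) {x : ℝ} {L : List (α × ℝ)} (h : ∀ a ∈ L, 0 ≤ a.2)
    (i : α) : region u x L i ⊆ Ici (u x) := by
  induction L generalizing x with
  | nil => exact empty_subset _
  | cons a L ih =>
    have ha := h a (by simp)
    rw [region_cons]
    refine union_subset ?_ ((ih fun b hb => h b (by simp [hb])).trans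
      (Ici_subset_Ici.2 (hu (by linarith))))
    split_ifs
    · exact Icc_subset_Ici_self
    · exact empty_subset _

lemma aedisjoint_Icc_region (hu : Monotone u) {x a : ℝ} {L : List (α × ℝ)}
    (h : ∀ b ∈ L, 0 ≤ b.2) (i : α) :
    AEDisjoint volume (Icc (u x) (u (x + a))) (region u (x + a) L i) := by
  refine measure_mono_null (t := {u (x + a)}) ?_ (by simp)
  rintro y ⟨hy, hy'⟩
  exact le_antisymm hy.2 (region_subset_Ici hu h i hy')

lemma aedisjoint_region (hu : Monotone u) {x : ℝ} {L : List (α × ℝ)} (h : ∀ a ∈ L, 0 ≤ a.2)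
    {i j : α} (hij : i ≠ j) : AEDisjoint volume (region u x L i) (region u x L j) := by
  induction L generalizing x with
  | nil => simp [AEDisjoint]
  | cons a L ih =>
    have hL : ∀ b ∈ L, 0 ≤ b.2 := fun b hb => h b (by simp [hb])
    simp only [region_cons, AEDisjoint.union_left_iff, AEDisjoint.union_right_iff]
    refine ⟨⟨?_, ?_⟩, ?_, ih hL⟩
    · split_ifs with h₁ h₂
      · exact absurd (h₁.symm.trans h₂) hij
      all_goals simp [AEDisjoint]
    · split_ifs
      · exact (aedisjoint_Icc_region hu hL i).symm
      · simp [AEDisjoint]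
    · split_ifs
      · exact aedisjoint_Icc_region hu hL j
      · simp [AEDisjoint]

lemma essBoundary_congr {E F : Set ℝ} (h : E =ᵐ[volume] F) : essBoundary E = essBoundary F := by
  ext x
  refine forall_congr' fun r => imp_congr_right fun _ => ?_
  rw [measure_congr ((ae_eq_refl (Ioo (x - r) (x + r))).inter h),
    measure_congr ((ae_eq_refl (Ioo (x - r) (x + r))).diff h)]

lemma essBoundary_union_subset (E F : Set ℝ) :
    essBoundary (E ∪ F) ⊆ essBoundary E ∪ essBoundary F := by
  intro x hx
  by_contra hn
  simp only [mem_union, not_or, essBoundary, mem_ofPred_eq, not_forall, not_and_or, not_lt,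
    nonpos_iff_eq_zero] at hn
  obtain ⟨⟨r, hr, h₁⟩, s, hs, h₂⟩ := hn
  have hmono : ∀ t, min r s ≤ t → Ioo (x - min r s) (x + min r s) ⊆ Ioo (x - t) (x + t) :=
    fun t ht => Ioo_subset_Ioo (by linarith) (by linarith)
  have hr' := hmono r (min_le_left _ _)
  have hs' := hmono s (min_le_right _ _)
  obtain ⟨h₃, h₄⟩ := hx (min r s) (lt_min hr hs)
  set I := Ioo (x - min r s) (x + min r s)
  have hdiff : ∀ {A : Set ℝ}, A ⊆ E ∪ F → volume (I \ A) ≠ 0 := fun hA h0 =>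
    h₄.ne' (measure_mono_null (sdiff_subset_sdiff_right hA) h0)
  rcases h₁ with h₁ | h₁
  · rcases h₂ with h₂ | h₂
    · refine h₃.ne' ?_
      rw [inter_union_distrib_left]
      exact measure_union_null (measure_mono_null (inter_subset_inter_left _ hr') h₁)
        (measure_mono_null (inter_subset_inter_left _ hs') h₂)
    · exact hdiff subset_union_right (measure_mono_null (sdiff_subset_sdiff_left hs') h₂)
  · exact hdiff subset_union_left (measure_mono_null (sdiff_subset_sdiff_left hr') h₁)

lemma essBoundary_empty : essBoundary ∅ = ∅ := by
  ext x
  simp only [essBoundary, mem_ofPred_eq, inter_empty, measure_empty, lt_irrefl, false_and,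
    imp_false, mem_empty_iff_false, iff_false, not_forall, not_not]
  exact ⟨1, one_pos⟩

lemma essBoundary_Icc_subset (a b : ℝ) : essBoundary (Icc a b) ⊆ {a, b} := by
  intro x hx
  by_contra hn
  simp only [mem_insert_iff, mem_singleton_iff, not_or] at hn
  have hr : 0 < min |x - a| |x - b| :=
    lt_min (abs_pos.2 (sub_ne_zero.2 hn.1)) (abs_pos.2 (sub_ne_zero.2 hn.2))
  obtain ⟨h₁, h₂⟩ := hx _ hr
  have ha := min_le_left |x - a| |x - b|
  have hb := min_le_right |x - a| |x - b|
  set r := min |x - a| |x - b|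
  obtain ⟨y, ⟨hy₁, hy₂⟩, hy₃, hy₄⟩ := nonempty_of_measure_ne_zero h₁.ne'
  obtain ⟨z, ⟨hz₁, hz₂⟩, hz₃⟩ := nonempty_of_measure_ne_zero h₂.ne'
  refine hz₃ ⟨?_, ?_⟩
  · rcases abs_cases (x - a) with h | h <;> linarith
  · rcases abs_cases (x - b) with h | h <;> linarith

/-- The division points of contiguous labelled intervals. -/
def divPoints {α : Type*} : ℝ → List (α × ℝ) → List ℝ
  | x, [] => [x]
  | x, a :: L => x :: divPoints (x + a.2) L

omit [DecidableEq α] in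
lemma cost_eq_sum (g : ℝ → ℝ) (x : ℝ) (L : List (α × ℝ)) :
    cost g x L = ((divPoints x L).map g).sum := by
  induction L generalizing x with
  | nil => simp [divPoints]
  | cons a L ih => simp [divPoints, ih]

lemma essBoundary_region_subset (x : ℝ) (L : List (α × ℝ)) (i : α) :
    essBoundary (region u x L i) ⊆ {y | y ∈ (divPoints x L).map u} := by
  induction L generalizing x with
  | nil => simp [essBoundary_empty]
  | cons a L ih =>
    rw [region_cons]
    refine (essBoundary_union_subset _ _).trans (union_subset ?_ ?_)
    · split_ifs
      · refine (essBoundary_Icc_subset _ _).trans ?_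
        have : x + a.2 ∈ divPoints (x + a.2) L := by cases L <;> simp [divPoints]
        rintro y (rfl | rfl)
        · simp [divPoints]
        · simp only [divPoints, List.map_cons, List.mem_cons, mem_ofPred_eq]
          exact Or.inr (List.mem_map_of_mem this)
      · simp [essBoundary_empty]
    · refine (ih _).trans fun y hy => ?_
      simp only [divPoints, List.map_cons, List.mem_cons, mem_ofPred_eq] at hy ⊢
      exact Or.inr hy

lemma tsum_le_list_sum (h : ℝ → ℝ≥0∞) (l : List ℝ) :
    ∑' x : {y | y ∈ l}, h x ≤ (l.map h).sum := by
  induction l with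
  | nil => simp
  | cons a l ih =>
    have e : {y | y ∈ a :: l} = {a} ∪ {y | y ∈ l} := by ext; simp
    rw [e, List.map_cons, List.sum_cons]
    refine (ENNReal.tsum_union_le h {a} {y | y ∈ l}).trans (add_le_add ?_ ih)
    rw [tsum_singleton]

lemma list_sum_ofReal (h : ℝ → ℝ) (hh : ∀ x, 0 ≤ h x) (l : List ℝ) :
    (l.map fun x => ENNReal.ofReal (h x)).sum = ENNReal.ofReal (l.map h).sum := by
  induction l with
  | nil => simp
  | cons a l ih =>
    rw [List.map_cons, List.sum_cons, ih, List.map_cons, List.sum_cons,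
      ENNReal.ofReal_add (hh a)]
    refine List.sum_nonneg fun y hy => ?_
    obtain ⟨z, -, rfl⟩ := List.mem_map.1 hy
    exact hh z

end Regions

namespace IsSymmLogConvex

variable {f : ℝ → ℝ} (hf : IsSymmLogConvex f)
include hf

lemma weightedVolume_Icc {p q : ℝ} (h : p ≤ q) :
    weightedVolume f (Icc p q) = ENNReal.ofReal (hf.volumeCoord q - hf.volumeCoord p) := by
  rw [volumeCoord_apply, volumeCoord_apply, hf.integral_sub, intervalIntegral.integral_of_le h,
    weightedVolume, ← ofReal_integral_eq_lintegral_ofReal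
      hf.continuous.integrableOn_Icc (Filter.Eventually.of_forall fun x => (hf.pos x).le),
    integral_Icc_eq_integral_Ioc]

end IsSymmLogConvex

lemma weightedVolume_congr (f : ℝ → ℝ) {E F : Set ℝ} (h : E =ᵐ[volume] F) :
    weightedVolume f E = weightedVolume f F := by
  rw [weightedVolume, weightedVolume, Measure.restrict_congr_set h]

lemma vol_nonneg {α : Type*} [DecidableEq α] {L : List (α × ℝ)} (h : ∀ a ∈ L, 0 ≤ a.2) (i : α) :
    0 ≤ vol i L := by
  induction L with
  | nil => simp
  | cons a L ih =>
    have h₁ := h a (by simp)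
    have h₂ := ih fun b hb => h b (by simp [hb])
    rw [vol_cons]
    split_ifs <;> linarith

namespace IsSymmLogConvex

variable {f : ℝ → ℝ} (hf : IsSymmLogConvex f)

section

include hf

lemma weightedVolume_region {α : Type*} [DecidableEq α] {L : List (α × ℝ)}
    (h : ∀ a ∈ L, 0 ≤ a.2) (x : ℝ) (i : α) :
    weightedVolume f (region hf.volumeCoord.symm x L i) = ENNReal.ofReal (vol i L) := by
  induction L generalizing x with
  | nil => simp [weightedVolume]
  | cons a L ih =>
    have ha := h a (by simp)
    have hL : ∀ b ∈ L, 0 ≤ b.2 := fun b hb => h b (by simp [hb])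
    have hmono := hf.volumeCoord.symm.monotone
    have := ih hL (x + a.2)
    rw [region_cons, vol_cons]
    split_ifs with hi
    · rw [weightedVolume, Measure.restrict_union₀ (aedisjoint_Icc_region hmono hL i)
        (measurableSet_region _ _ _).nullMeasurableSet, lintegral_add_measure,
        ENNReal.ofReal_add ha (vol_nonneg hL i), ← this, weightedVolume]
      congr 1
      have := hf.weightedVolume_Icc (hmono (le_add_of_nonneg_right (a := x) ha))
      rw [weightedVolume] at this
      rw [this, OrderIso.apply_symm_apply, OrderIso.apply_symm_apply, add_sub_cancel_left]
    · rw [empty_union, zero_add, this]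

lemma isTripleBubble_region {L : List (Fin 3 × ℝ)} (h : ∀ a ∈ L, 0 ≤ a.2) (x : ℝ) :
    IsTripleBubble f (fun i => vol i L) (region hf.volumeCoord.symm x L) where
  measurable := measurableSet_region x L
  disjoint _ _ hij := aedisjoint_region hf.volumeCoord.symm.monotone h hij
  volume_eq := hf.weightedVolume_region h x

/-- Only an inequality in general: zero lengths or equal neighbours give division points that
coincide or are no boundary points. An upper bound suffices for competitors; for the bubble under
study `exists_list` gives equality. -/
lemma weightedPerimeter_region_le (L : List (Fin 3 × ℝ)) (x : ℝ) :
    weightedPerimeter f (region hf.volumeCoord.symm x L)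
      ≤ ENNReal.ofReal (cost hf.pointCost x L) := by
  have hsub : (⋃ i, essBoundary (region hf.volumeCoord.symm x L i))
      ⊆ {y | y ∈ (divPoints x L).map hf.volumeCoord.symm} :=
    iUnion_subset fun i => essBoundary_region_subset x L i
  rw [weightedPerimeter]
  refine (ENNReal.tsum_mono_subtype (fun x => ENNReal.ofReal (f x)) hsub).trans
    ((tsum_le_list_sum (fun x => ENNReal.ofReal (f x)) _).trans_eq ?_)
  rw [list_sum_ofReal f (fun x => (hf.pos x).le), List.map_map, cost_eq_sum]
  rfl

/-- The density is at least `f 0 > 0`. This prevents a half line or the whole line from lying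
essentially in a bubble. -/
lemma weightedVolume_eq_top {E : Set ℝ} {S : Set ℝ} (hS : volume S = ∞)
    (h : volume (S \ E) = 0) : weightedVolume f E = ∞ := by
  have h₁ : volume E = ∞ := by
    rw [eq_top_iff, ← hS]
    exact measure_mono_ae (ae_le_set.2 h)
  rw [eq_top_iff, weightedVolume]
  calc ∞ = ∫⁻ _ in E, ENNReal.ofReal (f 0) := by
        rw [setLIntegral_const, h₁, ENNReal.mul_top]
        simpa using hf.pos 0
    _ ≤ _ := lintegral_mono fun x => ENNReal.ofReal_le_ofReal (hf.zero_le x)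

end

end IsSymmLogConvex

/-! ### From bubbles of finite perimeter to rows of intervals. -/

/-- A connected open set that avoids the boundary of `E` is essentially in `E` or outside. -/
lemma null_or_null_of_disjoint_essBoundary {E U : Set ℝ} (hU : IsPreconnected U)
    (h : ∀ x ∈ U, x ∉ essBoundary E) : volume (U ∩ E) = 0 ∨ volume (U \ E) = 0 := by
  have hopen : ∀ F : Set ℝ,
      IsOpen {x | ∃ r : ℝ, 0 < r ∧ volume (Ioo (x - r) (x + r) ∩ F) = 0} := by
    intro F
    rw [Metric.isOpen_iff]
    rintro x ⟨r, hr, h⟩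
    refine ⟨r / 2, by positivity, fun y hy => ⟨r / 2, by positivity, ?_⟩⟩
    rw [Metric.mem_ball, Real.dist_eq, abs_lt] at hy
    exact measure_mono_null (inter_subset_inter_left _ (Ioo_subset_Ioo (by linarith)
      (by linarith))) h
  have hnull : ∀ F : Set ℝ, U ⊆ {x | ∃ r : ℝ, 0 < r ∧ volume (Ioo (x - r) (x + r) ∩ F) = 0} →
      volume (U ∩ F) = 0 := by
    intro F hF
    refine measure_null_of_locally_null _ fun x hx => ?_
    obtain ⟨r, hr, h⟩ := hF hx.1
    refine ⟨Ioo (x - r) (x + r) ∩ F, ?_, h⟩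
    refine Filter.inter_mem (mem_nhdsWithin_of_mem_nhds (Ioo_mem_nhds ?_ ?_))
      (Filter.mem_of_superset self_mem_nhdsWithin inter_subset_right) <;> linarith
  by_contra hn
  rw [not_or, Set.sdiff_eq] at hn
  have hcover : U ⊆ {x | ∃ r : ℝ, 0 < r ∧ volume (Ioo (x - r) (x + r) ∩ E) = 0} ∪
      {x | ∃ r : ℝ, 0 < r ∧ volume (Ioo (x - r) (x + r) ∩ Eᶜ) = 0} := by
    intro x hx
    have := h x hx
    simp only [essBoundary, mem_ofPred_eq, not_forall, not_and_or, not_lt, nonpos_iff_eq_zero]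
      at this
    obtain ⟨r, hr, h | h⟩ := this
    · exact Or.inl ⟨r, hr, h⟩
    · exact Or.inr ⟨r, hr, by rwa [← Set.sdiff_eq]⟩
  have hne : ∀ F G : Set ℝ, volume (U ∩ F) ≠ 0 →
      U ⊆ {x | ∃ r : ℝ, 0 < r ∧ volume (Ioo (x - r) (x + r) ∩ F) = 0} ∪
        {x | ∃ r : ℝ, 0 < r ∧ volume (Ioo (x - r) (x + r) ∩ G) = 0} →
      (U ∩ {x | ∃ r : ℝ, 0 < r ∧ volume (Ioo (x - r) (x + r) ∩ G) = 0}).Nonempty := by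
    intro F G hF hFG
    by_contra hempty
    refine hF (hnull F fun x hx => (hFG hx).resolve_right fun hx' => hempty ⟨x, hx, hx'⟩)
  -- The points near which `E` is null and those near which its complement is null form two open
  -- sets covering `U`. If both met `U`, a common point would have a null neighbourhood.
  obtain ⟨x, -, ⟨r, hr, h₁⟩, s, hs, h₂⟩ := hU _ _ (hopen E) (hopen Eᶜ) hcover
    (hne _ _ hn.2 (by rwa [union_comm])) (hne _ _ hn.1 hcover)
  have : volume (Ioo (x - min r s) (x + min r s)) = 0 := by
    rw [← inter_union_compl (Ioo (x - min r s) (x + min r s)) E]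
    have hr' := min_le_left r s
    have hs' := min_le_right r s
    exact measure_union_null
      (measure_mono_null (inter_subset_inter_left _ (Ioo_subset_Ioo (by linarith)
        (by linarith))) h₁)
      (measure_mono_null (inter_subset_inter_left _ (Ioo_subset_Ioo (by linarith)
        (by linarith))) h₂)
  rw [Real.volume_Ioo, ENNReal.ofReal_eq_zero] at this
  have := lt_min hr hs
  linarith

section Extraction

variable {E : Fin 3 → Set ℝ}

/-- Between consecutive boundary points every bubble is null or of full measure, and disjointness
allows at most one of full measure; `none` stands for a gap. -/
lemma exists_label (hd : Pairwise fun i j => AEDisjoint volume (E i) (E j)) {p q : ℝ}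
    (hb : ∀ i, ∀ y ∈ Ioo p q, y ∉ essBoundary (E i)) :
    ∃ l : Option (Fin 3), ∀ i, (E i ∩ Ioo p q : Set ℝ) =ᵐ[volume]
      (if l = some i then Icc p q else ∅ : Set ℝ) := by
  have hnull : ∀ i, volume (Ioo p q ∩ E i) = 0 → (E i ∩ Ioo p q : Set ℝ) =ᵐ[volume] (∅ : Set ℝ) :=
    fun i hi => by rwa [ae_eq_empty, inter_comm]
  have h := fun i => null_or_null_of_disjoint_essBoundary isPreconnected_Ioo (hb i)
  by_cases hall : ∃ i, volume (Ioo p q \ E i) = 0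
  · obtain ⟨i, hi⟩ := hall
    refine ⟨some i, fun j => ?_⟩
    split_ifs with hij
    · obtain rfl : i = j := by simpa using hij
      refine Filter.EventuallyEq.trans ?_ Ioo_ae_eq_Icc
      rw [ae_eq_set]
      exact ⟨by simp [sdiff_eq_empty.2 inter_subset_right], by rwa [sdiff_inter_self_eq_sdiff]⟩
    · refine hnull j ?_
      refine measure_mono_null (t := (Ioo p q \ E i) ∪ (E i ∩ E j)) ?_
        (measure_union_null hi (hd fun e => hij (by rw [e])))
      rintro y ⟨hy, hy'⟩
      by_cases hyi : y ∈ E i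
      · exact Or.inr ⟨hyi, hy'⟩
      · exact Or.inl ⟨hy, hyi⟩
  · push Not at hall
    refine ⟨none, fun j => ?_⟩
    simp only [reduceCtorEq, if_false]
    exact hnull j ((h j).resolve_right (hall j))

lemma exists_list_of_sorted (hd : Pairwise fun i j => AEDisjoint volume (E i) (E j))
    (hfin : ∀ i q, volume (Ioi q \ E i) ≠ 0) (v : ℝ ≃o ℝ) (p : ℝ) (ps : List ℝ)
    (hs : (p :: ps).Pairwise (· < ·)) (hb : ∀ i, ∀ y, p < y → y ∉ ps → y ∉ essBoundary (E i)) :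
    ∃ L : List (Option (Fin 3) × ℝ), (∀ a ∈ L, 0 < a.2) ∧
      divPoints (v p) L = (p :: ps).map v ∧
      ∀ i, (E i ∩ Ioi p : Set ℝ) =ᵐ[volume] region v.symm (v p) L (some i) := by
  induction ps generalizing p with
  | nil =>
    refine ⟨[], by simp, rfl, fun i => ?_⟩
    rw [region_nil, ae_eq_empty, inter_comm]
    exact (null_or_null_of_disjoint_essBoundary isPreconnected_Ioi
      fun y hy => hb i y hy (by simp)).resolve_right (hfin i p)
  | cons q ps ih =>
    have hpq : p < q := by
      rw [List.pairwise_cons] at hs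
      exact hs.1 q (by simp)
    have hs' : (q :: ps).Pairwise (· < ·) := (List.pairwise_cons.1 hs).2
    have hq : ∀ y ∈ ps, q < y := (List.pairwise_cons.1 hs').1
    obtain ⟨L, h₁, h₂, h₃⟩ := ih q hs' fun i y hy hy' => hb i y (hpq.trans hy) (by
      rw [List.mem_cons, not_or]
      exact ⟨hy.ne', hy'⟩)
    obtain ⟨l, hl⟩ := exists_label hd fun i y hy => hb i y hy.1 (by
      rw [List.mem_cons, not_or]
      exact ⟨hy.2.ne, fun hy' => (hy.2.trans (hq y hy')).false⟩)
    have hvq : v p + (v q - v p) = v q := by ring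
    refine ⟨(l, v q - v p) :: L, ?_, ?_, fun i => ?_⟩
    · intro a ha
      rcases List.mem_cons.1 ha with rfl | ha
      · exact sub_pos.2 (v.strictMono hpq)
      · exact h₁ a ha
    · simp only [divPoints, hvq, h₂, List.map_cons]
    · rw [region_cons, hvq, v.symm_apply_apply, v.symm_apply_apply]
      refine Filter.EventuallyEq.trans ?_ ((hl i).union (h₃ i))
      rw [← inter_union_distrib_left]
      refine (ae_eq_refl _).inter ?_
      rw [← Ioc_union_Ioi_eq_Ioi hpq.le]
      exact Ioo_ae_eq_Ioc.symm.union (ae_eq_refl _)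

end Extraction

namespace IsSymmLogConvex

variable {f : ℝ → ℝ} (hf : IsSymmLogConvex f)
include hf

/-- A triple bubble of finite perimeter consists of finitely many intervals. -/
theorem exists_list {V : Fin 3 → ℝ} (hV : 0 < V 0) {E : Fin 3 → Set ℝ}
    (hE : IsTripleBubble f V E) (hP : weightedPerimeter f E ≠ ∞) :
    ∃ (x : ℝ) (L : List (Option (Fin 3) × ℝ)), (∀ a ∈ L, 0 < a.2) ∧
      weightedPerimeter f E = ENNReal.ofReal (cost hf.pointCost x L) ∧
      ∀ i, E i =ᵐ[volume] region hf.volumeCoord.symm x L (some i) := by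
  have hfin : ∀ i (S : Set ℝ), volume S = ∞ → volume (S \ E i) ≠ 0 := by
    intro i S hS h0
    have := hf.weightedVolume_eq_top hS h0
    rw [hE.volume_eq] at this
    exact ENNReal.ofReal_ne_top this
  set B := ⋃ i, essBoundary (E i) with hB
  -- Each boundary point costs at least `f 0 > 0`.
  have hBfin : B.Finite := by
    by_contra hinf
    have : Infinite B := Set.infinite_coe_iff.2 hinf
    refine hP (top_le_iff.1 ?_)
    rw [← ENNReal.tsum_const_eq_top_of_ne_zero (α := B) (c := ENNReal.ofReal (f 0))
      (by simpa using hf.pos 0)]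
    exact ENNReal.tsum_le_tsum fun x => ENNReal.ofReal_le_ofReal (hf.zero_le x)
  have hmemB : ∀ i y, y ∉ B → y ∉ essBoundary (E i) := fun i y hy hy' =>
    hy (mem_iUnion.2 ⟨i, hy'⟩)
  set l := hBfin.toFinset.sort (· ≤ ·) with hl
  have hmem : ∀ y, y ∈ l ↔ y ∈ B := fun y => by simp [hl]
  have hsort : l.Pairwise (· < ·) := Finset.sortedLT_sort _ |>.pairwise
  have hsum : weightedPerimeter f E = ENNReal.ofReal (l.map f).sum := by
    rw [← list_sum_ofReal f fun x => (hf.pos x).le, weightedPerimeter, ← hB]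
    have : (l.map fun x => ENNReal.ofReal (f x)).sum
        = ∑ x ∈ hBfin.toFinset, ENNReal.ofReal (f x) := by
      rw [Finset.sum, ← Finset.sort_eq (s := hBfin.toFinset) (r := (· ≤ ·)), Multiset.map_coe,
        Multiset.sum_coe]
    rw [this, ← Finset.tsum_subtype' hBfin.toFinset fun x => ENNReal.ofReal (f x), hBfin.coe_toFinset]
  match hcase : l with
  | [] =>
    exfalso
    have h0 : volume (E 0) = 0 := by
      have := (null_or_null_of_disjoint_essBoundary (E := E 0) isPreconnected_univ fun y _ =>
        hmemB 0 y fun hy => by simpa using (hmem y).2 hy).resolve_right (hfin 0 _ (by simp))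
      rwa [univ_inter] at this
    have := hE.volume_eq 0
    rw [weightedVolume, setLIntegral_measure_zero _ _ h0] at this
    exact (ENNReal.ofReal_pos.2 hV).ne this
  | p :: ps =>
    obtain ⟨L, h₁, h₂, h₃⟩ := exists_list_of_sorted hE.disjoint
      (fun i q => hfin i _ (by simp)) hf.volumeCoord p ps hsort fun i y hy hy' =>
        hmemB i y fun hyB => by
          rcases List.mem_cons.1 ((hmem y).2 hyB) with h | h
          · exact hy.ne' h
          · exact hy' h
    refine ⟨hf.volumeCoord p, L, h₁, ?_, fun i => ?_⟩
    · rw [hsum, cost_eq_sum, h₂, List.map_map]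
      congr 3
      ext y
      simp
    · refine Filter.EventuallyEq.trans ?_ (h₃ i)
      have hnull : volume (Iio p ∩ E i) = 0 :=
        (null_or_null_of_disjoint_essBoundary isPreconnected_Iio fun y hy =>
          hmemB i y fun hyB => by
            rcases List.mem_cons.1 ((hmem y).2 hyB) with h | h
            · exact (ne_of_lt hy) h
            · exact absurd ((List.pairwise_cons.1 hsort).1 y h) (not_lt.2 (le_of_lt hy))
          ).resolve_right (hfin i _ (by simp))
      rw [ae_eq_set]
      refine ⟨?_, by simp [sdiff_eq_empty.2 inter_subset_left]⟩
      refine measure_mono_null (t := (Iio p ∩ E i) ∪ {p}) ?_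
        (measure_union_null hnull (by simp))
      rintro y ⟨hy, hy'⟩
      rcases lt_trichotomy y p with h | h | h
      · exact Or.inl ⟨h, hy⟩
      · exact Or.inr h
      · exact absurd ⟨hy, h⟩ hy'

end IsSymmLogConvex

/-! ### Layouts, relabelling and reflection. -/

section Layout

variable {α : Type*} [DecidableEq α] {u : ℝ → ℝ}

lemma mem_region {x y : ℝ} {L : List (α × ℝ)} {i : α} :
    y ∈ region u x L i ↔
      ∃ P a S, L = P ++ (i, a) :: S ∧ y ∈ Icc (u (x + len P)) (u (x + len P + a)) := by
  induction L generalizing x with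
  | nil => simp
  | cons b L ih =>
    rw [region_cons, mem_union, ih]
    constructor
    · rintro (h | ⟨P, a, S, rfl, h⟩)
      · split_ifs at h with hb
        · exact ⟨[], b.2, L, by simp [← hb], by simpa using h⟩
        · exact h.elim
      · exact ⟨b :: P, a, S, rfl, by simpa [add_assoc] using h⟩
    · rintro ⟨P, a, S, h, hy⟩
      cases P with
      | nil =>
        rw [List.nil_append, List.cons.injEq] at h
        obtain ⟨rfl, rfl⟩ := h
        left
        simpa using hy
      | cons c P =>
        rw [List.cons_append, List.cons.injEq] at h
        obtain ⟨rfl, rfl⟩ := h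
        exact Or.inr ⟨P, a, S, rfl, by simpa [add_assoc] using hy⟩

lemma region_reverse (hodd : ∀ y, u (-y) = -u y) (x : ℝ) (L : List (α × ℝ)) (i : α) :
    region u (-(x + len L)) L.reverse i = {y | -y ∈ region u x L i} := by
  have key : ∀ (x : ℝ) (L : List (α × ℝ)) (y : ℝ),
      -y ∈ region u x L i → y ∈ region u (-(x + len L)) L.reverse i := by
    intro x L y hy
    obtain ⟨P, a, S, rfl, h₁, h₂⟩ := mem_region.1 hy
    refine mem_region.2 ⟨S.reverse, a, P.reverse, by simp, ?_, ?_⟩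
    · have : -(x + len (P ++ (i, a) :: S)) + len S.reverse = -(x + len P + a) := by simp; ring
      rw [this, hodd]
      linarith
    · have : -(x + len (P ++ (i, a) :: S)) + len S.reverse + a = -(x + len P) := by simp; ring
      rw [this, hodd]
      linarith
  ext y
  refine ⟨fun hy => ?_, key x L y⟩
  have := key (-(x + len L)) L.reverse (-y) (by rwa [neg_neg])
  rwa [List.reverse_reverse, len_reverse, show -(-(x + len L) + len L) = x by ring] at this

lemma hasLayout_of_ae_eq_region (hu : StrictMono u) {x : ℝ} {L : List (Fin 3 × ℝ)}
    (hL : ∀ a ∈ L, 0 < a.2) {E : Fin 3 → Set ℝ} (hE : ∀ i, E i =ᵐ[volume] region u x L i)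
    {w : List (Fin 3)} (hw : L.map Prod.fst = w) : HasLayout w E := by
  subst hw
  have hlen : ∀ j : Fin (L.map Prod.fst).length, (j : ℕ) < L.length := fun j => by
    simpa using j.2
  have htake : ∀ j (hj : j < L.length), len (L.take (j + 1)) = len (L.take j) + L[j].2 := by
    intro j hj
    rw [List.take_add_one, List.getElem?_eq_getElem hj, len_append]
    simp
  refine ⟨fun j => u (x + len (L.take j)), ?_, fun i => ?_⟩
  · refine Fin.strictMono_iff_lt_succ.2 fun j => hu ?_
    have := hL _ (List.getElem_mem (hlen j))
    simp only [Fin.val_castSucc, Fin.val_succ, htake j (hlen j)]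
    linarith
  · refine (hE i).trans (Filter.EventuallyEq.of_eq (Set.ext fun y => ?_))
    simp only [mem_region, mem_iUnion, exists_prop, Fin.val_castSucc, Fin.val_succ]
    constructor
    · rintro ⟨P, a, S, h, hy⟩
      have hP : P.length < L.length := by rw [h]; simp
      refine ⟨⟨P.length, by simpa using hP⟩, ?_, ?_⟩
      · simp [h]
      · have h₁ : L.take P.length = P := by rw [h]; simp
        have h₂ : L[P.length] = (i, a) := by simp [h]
        rw [htake _ hP, h₁, h₂, ← add_assoc]
        exact hy
    · rintro ⟨j, hj, hy⟩
      refine ⟨L.take j, L[j.1].2, L.drop (j + 1), ?_, ?_⟩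
      · have h₁ : L[j.1].1 = i := by rw [← hj]; simp
        rw [← h₁]
        simp
      · rw [htake _ (hlen j), ← add_assoc] at hy
        exact hy

lemma hasLayout_of_map_eq (hu : StrictMono u) {x : ℝ} {L : List (Fin 3 × ℝ)}
    (hL : ∀ a ∈ L, 0 < a.2) {E : Fin 3 → Set ℝ} (hE : ∀ i, E i =ᵐ[volume] region u x L i)
    {w : List (Fin 3)} (σ : Equiv.Perm (Fin 3)) (hw : L.map Prod.fst = w.map σ) :
    HasLayout w (fun i => E (σ i)) := by
  refine hasLayout_of_ae_eq_region hu (x := x) (L := L.map fun a => (σ.symm a.1, a.2)) ?_ ?_ ?_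
  · intro a ha
    obtain ⟨b, hb, rfl⟩ := List.mem_map.1 ha
    exact hL b hb
  · intro i
    have := region_map (u := u) σ.symm x L (σ i)
    rw [Equiv.symm_apply_apply] at this
    rw [this]
    exact hE (σ i)
  · have := congrArg (List.map σ.symm) hw
    rw [List.map_map, List.map_map] at this
    simpa [Function.comp_def] using this

lemma reflectBubble_ae_eq {E F : Fin 3 → Set ℝ} (h : ∀ i, E i =ᵐ[volume] F i) (i : Fin 3) :
    reflectBubble E i =ᵐ[volume] reflectBubble F i :=
  (Measure.measurePreserving_neg (volume : Measure ℝ)).quasiMeasurePreserving.preimage_ae_eq (h i)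

end Layout

/-- Two sorted arrangements of the same three volumes agree, even with ties. Thus the relabelling of
a minimal word only exchanges bubbles of equal volume. -/
lemma eq_of_sorted {V : Fin 3 → ℝ} (h₁ : V 0 ≤ V 1) (h₂ : V 1 ≤ V 2) {i j k : Fin 3}
    (hij : i ≠ j) (hjk : j ≠ k) (hik : i ≠ k) (h₃ : V i ≤ V j) (h₄ : V j ≤ V k) :
    V i = V 0 ∧ V j = V 1 ∧ V k = V 2 := by
  fin_cases i <;> fin_cases j <;> fin_cases k <;> simp_all <;> constructorm* _ ∧ _ <;> linarith

/-! ### Perimeter-minimizing bubbles and rows of least cost; part (a). -/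

namespace IsSymmLogConvex

variable {f : ℝ → ℝ} (hf : IsSymmLogConvex f)
include hf

lemma volumeCoord_symm_neg (y : ℝ) : hf.volumeCoord.symm (-y) = -hf.volumeCoord.symm y := by
  rw [OrderIso.symm_apply_eq, volumeCoord_apply, hf.integral_neg, ← hf.volumeCoord_apply,
    OrderIso.apply_symm_apply]

lemma vol_eq_of_ae_eq_region {V : Fin 3 → ℝ} (hV : ∀ i, 0 ≤ V i) {E : Fin 3 → Set ℝ}
    (hE : IsTripleBubble f V E) {x : ℝ} {L : List (Option (Fin 3) × ℝ)} (hL : ∀ a ∈ L, 0 ≤ a.2)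
    (h : ∀ i, E i =ᵐ[volume] region hf.volumeCoord.symm x L (some i)) (i : Fin 3) :
    vol (some i) L = V i := by
  have h₁ := hE.volume_eq i
  rw [weightedVolume_congr f (h i), hf.weightedVolume_region hL] at h₁
  exact (ENNReal.ofReal_eq_ofReal_iff (vol_nonneg hL _) (hV i)).1 h₁

/-- A perimeter-minimizing triple bubble is given by a sequence of intervals of least cost. -/
theorem exists_leastCost {V : Fin 3 → ℝ} (hV : ∀ i, 0 < V i) {E : Fin 3 → Set ℝ}
    (hE : IsPerimeterMinimizing f V E) :
    ∃ (x : ℝ) (L : List (Fin 3 × ℝ)), LeastCost hf.pointCost x L ∧ (∀ i, vol i L = V i) ∧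
      ∀ i, E i =ᵐ[volume] region hf.volumeCoord.symm x L i := by
  have hle : ∀ (x' : ℝ) (L' : List (Fin 3 × ℝ)), (∀ a ∈ L', 0 ≤ a.2) → (∀ i, vol i L' = V i) →
      weightedPerimeter f E ≤ ENNReal.ofReal (cost hf.pointCost x' L') := by
    intro x' L' h₁ h₂
    have h₃ := hf.isTripleBubble_region h₁ x'
    rw [show (fun i => vol i L') = V from funext h₂] at h₃
    exact (hE.2 _ h₃).trans (hf.weightedPerimeter_region_le L' x')
  have hfin : weightedPerimeter f E ≠ ∞ := by
    refine ne_top_of_le_ne_top ENNReal.ofReal_ne_top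
      (hle 0 [(0, V 0), (1, V 1), (2, V 2)] ?_ ?_)
    · simp [(hV _).le]
    · intro i
      fin_cases i <;> simp
  obtain ⟨x, L, h₁, h₂, h₃⟩ := hf.exists_list (hV 0) hE.1 hfin
  have hL : ∀ a ∈ L, 0 ≤ a.2 := fun a ha => (h₁ a ha).le
  have hv := hf.vol_eq_of_ae_eq_region (fun i => (hV i).le) hE.1 hL h₃
  have hle' : ∀ (x' : ℝ) (L' : List (Fin 3 × ℝ)), (∀ a ∈ L', 0 ≤ a.2) → (∀ i, vol i L' = V i) →
      cost hf.pointCost x L ≤ cost hf.pointCost x' L' := by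
    intro x' L' h₄ h₅
    have := hle x' L' h₄ h₅
    rwa [h₂, ENNReal.ofReal_le_ofReal_iff (cost_pos hf.isConvexWell _ _).le] at this
  rcases exists_withGaps hf.isConvexWell x L hL with ⟨L', rfl⟩ | ⟨x', L', h₄, h₅, h₆⟩
  · refine ⟨x, L', ⟨fun a ha => h₁ (some a.1, a.2) (List.mem_map_of_mem ha), ?_⟩, ?_, ?_⟩
    · intro x' L'' h₄ h₅
      rw [← cost_withGaps]
      exact hle' x' L'' h₄ fun i => by rw [h₅, ← vol_withGaps, hv]
    · exact fun i => by rw [← vol_withGaps, hv]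
    · exact fun i => by rw [← region_withGaps]; exact h₃ i
  · exact absurd (hle' x' L' h₄ fun i => (h₅ i).trans (hv i)) (not_le.2 h₆)

/-- A sequence of intervals of least cost is a perimeter-minimizing triple bubble. -/
theorem isPerimeterMinimizing_region {x : ℝ} {L : List (Fin 3 × ℝ)}
    (h : LeastCost hf.pointCost x L) (hpos : 0 < vol 0 L) :
    IsPerimeterMinimizing f (fun i => vol i L) (region hf.volumeCoord.symm x L) := by
  refine ⟨hf.isTripleBubble_region h.nonneg x, fun E hE => ?_⟩
  by_cases hfin : weightedPerimeter f E = ∞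
  · rw [hfin]
    exact le_top
  refine (hf.weightedPerimeter_region_le L x).trans ?_
  obtain ⟨x', L', h₁, h₂, h₃⟩ := hf.exists_list hpos hE hfin
  have hL' : ∀ a ∈ L', 0 ≤ a.2 := fun a ha => (h₁ a ha).le
  have hv := hf.vol_eq_of_ae_eq_region (fun i => vol_nonneg h.nonneg i) hE hL' h₃
  rw [h₂]
  refine ENNReal.ofReal_le_ofReal ?_
  rcases exists_withGaps hf.isConvexWell x' L' hL' with ⟨L'', rfl⟩ | ⟨x'', L'', h₄, h₅, h₆⟩
  · rw [cost_withGaps]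
    exact h.le x' L'' (fun a ha => hL' (some a.1, a.2) (List.mem_map_of_mem ha)) fun i => by
      rw [← vol_withGaps, hv]
  · exact (h.le x'' L'' h₄ fun i => (h₅ i).trans (hv i)).trans h₆.le

/-- Perimeter-minimizing triple bubbles are of one of the four types. -/
theorem exists_isOfType {V : Fin 3 → ℝ} (h₀ : 0 < V 0) (h₁ : V 0 ≤ V 1) (h₂ : V 1 ≤ V 2)
    {E : Fin 3 → Set ℝ} (hE : IsPerimeterMinimizing f V E) :
    ∃ w ∈ fourTypes, IsOfType V w E ∨ IsOfType V w (reflectBubble E) := by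
  have hV : ∀ i, 0 < V i := by
    intro i
    fin_cases i <;> simp only [Fin.mk_one, Fin.zero_eta, Fin.reduceFinMk] <;> linarith
  obtain ⟨x, L, hmin, hvol, hEL⟩ := hf.exists_leastCost hV hE
  have hw := hmin.isMinimalWord hf.isConvexWell fun i => by rw [hvol]; exact hV i
  rw [show (fun i => vol i L) = V from funext hvol] at hw
  obtain ⟨i, j, k, hij, hjk, hik, h₃, h₄, hw⟩ := hw
  obtain ⟨σ, rfl, rfl, rfl⟩ : ∃ σ : Equiv.Perm (Fin 3), σ 0 = i ∧ σ 1 = j ∧ σ 2 = k := by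
    clear * - hij hjk hik
    revert i j k
    decide
  have hσ : ∀ n, V (σ n) = V n := by
    obtain ⟨h₅, h₆, h₇⟩ := eq_of_sorted h₁ h₂ hij hjk hik h₃ h₄
    intro n
    fin_cases n
    · exact h₅
    · exact h₆
    · exact h₇
  have hu := hf.volumeCoord.symm.strictMono
  have key₁ : ∀ w, L.map Prod.fst = w.map σ → IsOfType V w E := fun w h =>
    ⟨σ, hσ, hasLayout_of_map_eq hu hmin.pos hEL σ h⟩
  have key₂ : ∀ w, L.map Prod.fst = (w.map σ).reverse → IsOfType V w (reflectBubble E) := by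
    intro w h
    refine ⟨σ, hσ, hasLayout_of_map_eq hu (x := -(x + len L)) (hmin.reverse hf.isConvexWell).pos
      (fun n => ?_) σ (by rw [List.map_reverse, h, List.reverse_reverse])⟩
    rw [region_reverse hf.volumeCoord_symm_neg]
    exact reflectBubble_ae_eq hEL n
  rcases hw with h | h | h | h | h | h | h
  · exact ⟨[1, 0, 2], by simp [fourTypes], Or.inl (key₁ _ h)⟩
  · exact ⟨[1, 0, 2], by simp [fourTypes], Or.inr (key₂ _ h)⟩
  · exact ⟨[2, 0, 1, 2], by simp [fourTypes], Or.inl (key₁ _ h)⟩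
  · exact ⟨[2, 0, 1, 2], by simp [fourTypes], Or.inr (key₂ _ h)⟩
  · exact ⟨[1, 2, 0, 2], by simp [fourTypes], Or.inl (key₁ _ h)⟩
  · exact ⟨[1, 2, 0, 2], by simp [fourTypes], Or.inr (key₂ _ h)⟩
  -- This word is its own reversal, so it needs no reflected case.
  · exact ⟨[2, 1, 0, 1, 2], by simp [fourTypes], Or.inl (key₁ _ h)⟩

end IsSymmLogConvex

/-! ### Existence of rows of least cost. -/

section Existence

variable {g : ℝ → ℝ}

namespace IsConvexWell

lemma continuous (hg : IsConvexWell g) : Continuous g :=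
  continuousOn_univ.1 (hg.convex.continuousOn isOpen_univ)

lemma zero_le (hg : IsConvexWell g) (x : ℝ) : g 0 ≤ g x := hg.le_of_abs_le (by simp)

/-- Convexity and `g 0 < g 1` force at least linear growth. This confines the starting point of a
competitor. -/
lemma exists_bound (hg : IsConvexWell g) (C : ℝ) : ∃ M, ∀ x, g x ≤ C → |x| ≤ M := by
  have h₁ : 0 < g 1 - g 0 := sub_pos.2 (hg.lt_of_abs_lt (by simp))
  refine ⟨max 1 (C / (g 1 - g 0)), fun x hx => ?_⟩
  by_contra! hlt
  obtain ⟨hy₁, hy₂⟩ := max_lt_iff.1 hlt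
  rw [← hg.apply_abs] at hx
  set y := |x|
  have hy : 0 < y := by linarith
  have h := hg.convex.2 (mem_univ 0) (mem_univ y) (show 0 ≤ 1 - 1 / y from
    sub_nonneg.2 ((div_le_one hy).2 hy₁.le)) (show 0 ≤ 1 / y by positivity) (by ring)
  have e : (1 - 1 / y) • (0 : ℝ) + (1 / y) • y = 1 := by
    simp only [smul_eq_mul]; field_simp; ring
  rw [e] at h
  simp only [smul_eq_mul] at h
  have h₂ := mul_le_mul_of_nonneg_left h hy.le
  have h₃ : y * ((1 - 1 / y) * g 0 + 1 / y * g y) = y * g 0 - g 0 + g y := by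
    field_simp
  rw [div_lt_iff₀ h₁] at hy₂
  nlinarith [hg.pos 0]

end IsConvexWell

variable {α : Type*}

lemma apply_le_cost (hg : IsConvexWell g) (x : ℝ) (L : List (α × ℝ)) : g x ≤ cost g x L := by
  cases L with
  | nil => exact le_rfl
  | cons a L => exact le_add_of_nonneg_right (cost_pos hg _ _).le

lemma length_mul_le_cost (hg : IsConvexWell g) (x : ℝ) (L : List (α × ℝ)) :
    L.length * g 0 ≤ cost g x L := by
  induction L generalizing x with
  | nil => simpa using (hg.pos x).le
  | cons a L ih =>
    have h₁ := ih (x + a.2)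
    have h₂ := hg.zero_le x
    rw [List.length_cons, cost_cons]
    push_cast
    linarith

lemma le_vol [DecidableEq α] {L : List (α × ℝ)} (h : ∀ a ∈ L, 0 ≤ a.2) {a : α × ℝ} (ha : a ∈ L) :
    a.2 ≤ vol a.1 L := by
  obtain ⟨P, S, rfl⟩ := List.append_of_mem ha
  have h₁ := vol_nonneg (L := P) (fun b hb => h b (by simp [hb])) a.1
  have h₂ := vol_nonneg (L := S) (fun b hb => h b (by simp [hb])) a.1
  simp
  linarith

lemma continuous_cost (hg : IsConvexWell g) {n : ℕ} (w : Fin n → α) {X : Type*}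
    [TopologicalSpace X] {s : X → ℝ} {l : X → Fin n → ℝ} (hs : Continuous s) (hl : Continuous l) :
    Continuous fun p => cost g (s p) (List.ofFn fun j => (w j, l p j)) := by
  induction n generalizing s with
  | zero => simpa [Function.comp_def] using hg.continuous.comp hs
  | succ n ih =>
    simp only [List.ofFn_succ, cost_cons]
    have h₀ : Continuous fun p => l p 0 := (continuous_apply 0).comp hl
    exact (hg.continuous.comp hs).add (ih (fun j => w j.succ) (l := fun p j => l p j.succ)
      (hs.add h₀) (continuous_pi fun j => (continuous_apply j.succ).comp hl))

lemma continuous_vol [DecidableEq α] {n : ℕ} (w : Fin n → α) (i : α) :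
    Continuous fun l : Fin n → ℝ => vol i (List.ofFn fun j => (w j, l j)) := by
  induction n with
  | zero => simpa using continuous_const
  | succ n ih =>
    simp only [List.ofFn_succ, vol_cons]
    refine Continuous.add ?_ ((ih fun j => w j.succ).comp
      (continuous_pi fun j => continuous_apply j.succ))
    split_ifs
    · exact continuous_apply 0
    · exact continuous_const

/-- Least cost is attained for given volumes. -/
theorem exists_leastCost_vol_eq [Fintype α] [DecidableEq α] (hg : IsConvexWell g) {V : α → ℝ}
    {L₀ : List (α × ℝ)} (hL₀ : ∀ a ∈ L₀, 0 ≤ a.2) (hV : ∀ i, vol i L₀ = V i) :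
    ∃ x L, LeastCost g x L ∧ ∀ i, vol i L = V i := by
  set C := cost g 0 L₀
  obtain ⟨M, hM⟩ := hg.exists_bound C
  obtain ⟨N, hN⟩ := exists_nat_gt (C / g 0)
  let list : ∀ n, (Fin n → α) → (Fin n → ℝ) → List (α × ℝ) := fun n w l =>
    List.ofFn fun j => (w j, l j)
  -- For each word the admissible rows form a compact set: the start is bounded by `M` and each
  -- length by the volume of its bubble. Only words shorter than `N` matter, since every division
  -- point costs at least `g 0`.
  let K : ∀ n, (Fin n → α) → Set (ℝ × (Fin n → ℝ)) := fun n w =>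
    (Icc (-M) M ×ˢ Icc 0 (fun j => V (w j))) ∩ {p | ∀ i, vol i (list n w p.2) = V i}
  have hK : ∀ n w, IsCompact (K n w) := fun n w =>
    (isCompact_Icc.prod isCompact_Icc).inter_right <| by
      rw [ofPred_forall]
      exact isClosed_iInter fun i => isClosed_eq ((continuous_vol w i).comp continuous_snd)
        continuous_const
  let S : Set ℝ := ⋃ n : Fin N, ⋃ w : Fin n → α,
    (fun p : ℝ × (Fin n → ℝ) => cost g p.1 (list n w p.2)) '' K n w
  have hS : IsCompact S := isCompact_iUnion fun n => isCompact_iUnion fun w =>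
    (hK n w).image (continuous_cost hg w continuous_fst continuous_snd)
  have hmem : ∀ x (L : List (α × ℝ)), (∀ a ∈ L, 0 ≤ a.2) → (∀ i, vol i L = V i) →
      cost g x L ≤ C → cost g x L ∈ S := by
    intro x L h₁ h₂ h₃
    have hn : L.length < N := by
      have := (length_mul_le_cost hg x L).trans h₃
      rw [div_lt_iff₀ (hg.pos 0)] at hN
      have := lt_of_mul_lt_mul_right (this.trans_lt hN) (hg.pos 0).le
      exact_mod_cast this
    have e : list L.length (fun j => (L.get j).1) (fun j => (L.get j).2) = L := List.ofFn_get L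
    refine mem_iUnion.2 ⟨⟨L.length, hn⟩, mem_iUnion.2 ⟨fun j => (L.get j).1,
      (x, fun j => (L.get j).2), ⟨⟨abs_le.1 (hM x ((apply_le_cost hg x L).trans h₃)), ?_, ?_⟩, ?_⟩,
      ?_⟩⟩
    · exact fun j => h₁ _ (List.get_mem L j)
    · intro j
      simp only [← h₂]
      exact le_vol h₁ (List.get_mem L j)
    · intro i
      simp only [e, h₂]
    · simp only [e]
  obtain ⟨c, hc, hmin⟩ := hS.exists_isLeast ⟨C, hmem 0 L₀ hL₀ hV le_rfl⟩
  obtain ⟨n, hc⟩ := mem_iUnion.1 hc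
  obtain ⟨w, ⟨x, l⟩, ⟨⟨-, hl, -⟩, hvol⟩, rfl⟩ := mem_iUnion.1 hc
  simp only at hmin hl
  replace hvol : ∀ i, vol i (list n w l) = V i := hvol
  have hnonneg : ∀ a ∈ list n w l, 0 ≤ a.2 := by
    intro a ha
    obtain ⟨j, rfl⟩ := (List.mem_ofFn' _ _).1 ha
    exact hl j
  have hle : ∀ x' L', (∀ a ∈ L', 0 ≤ a.2) → (∀ i, vol i L' = V i) →
      cost g x (list n w l) ≤ cost g x' L' := by
    intro x' L' h₁ h₂
    rcases le_total (cost g x' L') C with h | h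
    · exact hmin (hmem x' L' h₁ h₂ h)
    · exact (hmin (hmem 0 L₀ hL₀ hV le_rfl)).trans h
  refine ⟨x, list n w l, ⟨fun a ha => ?_, fun x' L' h₁ h₂ => hle x' L' h₁ fun i => ?_⟩, hvol⟩
  -- Removing a piece of length zero would save a division point.
  · refine (hnonneg a ha).lt_of_ne fun h0 => ?_
    obtain ⟨P, S, hPS⟩ := List.append_of_mem ha
    rw [hPS] at hle hvol hnonneg
    have := hle x (P ++ S) (fun b hb => hnonneg b (by
      simp only [List.mem_append, List.mem_cons] at hb ⊢; tauto)) fun i => by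
        rw [← hvol i]; simp [← h0]
    simp only [cost_append, cost_cons, ← h0, add_zero] at this
    linarith [hg.pos (x + len P)]
  · rw [h₂, hvol]

end Existence

/-! ### Quadratic costs: volumes for which each type is optimal. -/

section QuadraticCost

variable {g : ℝ → ℝ}

/-- A convex cost lies above the tangents of a parabola with which it agrees near the origin. -/
lemma tangent_le (hg : IsConvexWell g) {R : ℝ} (hq : ∀ y, |y| ≤ R → g y = 1 + y ^ 2) {c : ℝ}
    (hc : |c| < R) (v : ℝ) : 1 + 2 * c * v - c ^ 2 ≤ g v := by
  -- For `v` beyond `R`, convexity puts `g v` above the line through the points of the parabola at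
  -- `c` and `R`, which at `v` lies above the tangent at `c`.
  have key : ∀ c v : ℝ, |c| < R → R < v → 1 + 2 * c * v - c ^ 2 ≤ g v := by
    intro c v hc hv
    have hcR := (abs_lt.1 hc).2
    have hvc : 0 < v - c := by linarith
    have h := hg.convex.2 (mem_univ c) (mem_univ v) (div_nonneg (sub_pos.2 hv).le hvc.le)
      (div_nonneg (sub_pos.2 hcR).le hvc.le) (by field_simp; ring)
    have e : ((v - R) / (v - c)) • c + ((R - c) / (v - c)) • v = R := by
      simp only [smul_eq_mul]; field_simp; ring
    rw [e, hq c hc.le, hq R (by rw [abs_of_pos ((abs_nonneg c).trans_lt hc)])] at h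
    simp only [smul_eq_mul] at h
    have h₁ := mul_le_mul_of_nonneg_left h hvc.le
    have e₁ : (v - c) * ((v - R) / (v - c) * (1 + c ^ 2) + (R - c) / (v - c) * g v)
        = (v - R) * (1 + c ^ 2) + (R - c) * g v := by
      field_simp
    rw [e₁] at h₁
    refine le_of_mul_le_mul_left ?_ (sub_pos.2 hcR)
    nlinarith [mul_nonneg hvc.le (sq_nonneg (R - c))]
  rcases le_or_gt |v| R with hv | hv
  · rw [hq v hv]
    nlinarith [sq_nonneg (v - c)]
  · rcases lt_abs.1 hv with hv | hv
    · exact key c v hc hv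
    · rw [← hg.even v]
      have := key (-c) (-v) (by rwa [abs_neg]) hv
      linarith

lemma map_fst_eq_cons {α : Type*} {L : List (α × ℝ)} {i : α} {w : List α}
    (h : L.map Prod.fst = i :: w) : ∃ a L', L = (i, a) :: L' ∧ L'.map Prod.fst = w := by
  obtain ⟨⟨j, a⟩, L', rfl, rfl, h'⟩ := List.map_eq_cons_iff.1 h
  exact ⟨a, L', rfl, h'⟩

/-- Strictly ordered volumes fix the labels, and passing to the reversed row if necessary reduces
the seven minimal words to four. -/
lemma exists_leastCost_fourTypes (hg : IsConvexWell g) {L₀ : List (Fin 3 × ℝ)}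
    (hL₀ : ∀ a ∈ L₀, 0 ≤ a.2) (h₀ : 0 < vol 0 L₀) (h₁ : vol 0 L₀ < vol 1 L₀)
    (h₂ : vol 1 L₀ < vol 2 L₀) : ∃ x L, LeastCost g x L ∧ (∀ i, vol i L = vol i L₀) ∧
      (L.map Prod.fst = [1, 0, 2] ∨ L.map Prod.fst = [2, 0, 1, 2] ∨
        L.map Prod.fst = [1, 2, 0, 2] ∨ L.map Prod.fst = [2, 1, 0, 1, 2]) := by
  obtain ⟨x, L, hL, hvol⟩ := exists_leastCost_vol_eq hg hL₀ (V := fun i => vol i L₀) fun _ => rfl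
  obtain ⟨i, j, k, hij, hjk, hik, h₃, h₄, hw⟩ := hL.isMinimalWord hg fun i => by
    rw [hvol]
    fin_cases i <;> simp only [Fin.mk_one, Fin.zero_eta, Fin.reduceFinMk] <;> linarith
  simp only [hvol] at h₃ h₄
  obtain ⟨rfl, rfl, rfl⟩ : i = 0 ∧ j = 1 ∧ k = 2 := by
    fin_cases i <;> fin_cases j <;> fin_cases k <;>
      simp only [Fin.mk_one, Fin.zero_eta, Fin.reduceFinMk] at h₃ h₄ <;> first
      | exact absurd rfl hij
      | exact absurd rfl hjk
      | exact absurd rfl hik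
      | exact ⟨rfl, rfl, rfl⟩
      | (exfalso; linarith)
  have hr := hL.reverse hg
  have hvr : ∀ i, vol i L.reverse = vol i L₀ := fun i => (vol_reverse i L).trans (hvol i)
  rcases hw with h | h | h | h | h | h | h
  · exact ⟨x, L, hL, hvol, by simp [h]⟩
  · exact ⟨_, _, hr, hvr, by simp [h]⟩
  · exact ⟨x, L, hL, hvol, by simp [h]⟩
  · exact ⟨_, _, hr, hvr, by simp [h]⟩
  · exact ⟨x, L, hL, hvol, by simp [h]⟩
  · exact ⟨_, _, hr, hvr, by simp [h]⟩
  · exact ⟨x, L, hL, hvol, by simp [h]⟩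

section Bounds

variable {x v₀ v₁ v₂ : ℝ} {L : List (Fin 3 × ℝ)}
  (ht : ∀ c v, |c| < 100 → 1 + 2 * c * v - c ^ 2 ≤ g v)
  (h₀ : vol 0 L = v₀) (h₁ : vol 1 L = v₁) (h₂ : vol 2 L = v₂)

include ht h₀ h₁ h₂

/-- Each division point is bounded by a tangent of the parabola, and the tangency points sum to zero
so that `x` cancels. In the longer words they are also arranged so that only the total volume of a
split bubble enters. -/
lemma le_cost_word_213 (h : L.map Prod.fst = [1, 0, 2]) {p q r s : ℝ} (hsum : p + q + r + s = 0)
    (hp : |p| < 100) (hq : |q| < 100) (hr : |r| < 100) (hs : |s| < 100) :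
    4 + 2 * (q * v₁ + r * (v₁ + v₀) + s * (v₁ + v₀ + v₂)) - p ^ 2 - q ^ 2 - r ^ 2 - s ^ 2
      ≤ cost g x L := by
  obtain ⟨a, L, rfl, h₃⟩ := map_fst_eq_cons h
  obtain ⟨b, L, rfl, h₄⟩ := map_fst_eq_cons h₃
  obtain ⟨c, L, rfl, h₅⟩ := map_fst_eq_cons h₄
  obtain rfl := List.map_eq_nil_iff.1 h₅
  simp at h₀ h₁ h₂
  subst h₀ h₁ h₂
  obtain rfl : p = -(q + r + s) := by linarith
  simp only [cost_cons, cost_nil]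
  linarith [ht _ x hp, ht _ (x + a) hq, ht _ (x + a + b) hr, ht _ (x + a + b + c) hs]

lemma le_cost_word_3123 (h : L.map Prod.fst = [2, 0, 1, 2]) {p q r s : ℝ} (hsum : q + r + s = 0)
    (hp : |p| < 100) (hq : |q| < 100) (hr : |r| < 100) (hs : |s| < 100) :
    5 + 2 * p * (v₀ + v₁ + v₂) - 2 * p ^ 2 + 2 * (r * v₀ + s * (v₀ + v₁)) - q ^ 2 - r ^ 2 - s ^ 2
      ≤ cost g x L := by
  obtain ⟨a, L, rfl, h₃⟩ := map_fst_eq_cons h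
  obtain ⟨b, L, rfl, h₄⟩ := map_fst_eq_cons h₃
  obtain ⟨c, L, rfl, h₅⟩ := map_fst_eq_cons h₄
  obtain ⟨d, L, rfl, h₆⟩ := map_fst_eq_cons h₅
  obtain rfl := List.map_eq_nil_iff.1 h₆
  simp at h₀ h₁ h₂
  subst h₀ h₁ h₂
  obtain rfl : q = -(r + s) := by linarith
  simp only [cost_cons, cost_nil]
  have hp' : |-p| < 100 := by rwa [abs_neg]
  linarith [ht _ x hp', ht _ (x + a) hq, ht _ (x + a + b) hr, ht _ (x + a + b + c) hs,
    ht _ (x + a + b + c + d) hp]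

lemma le_cost_word_2313 (h : L.map Prod.fst = [1, 2, 0, 2]) {p q r : ℝ} (hsum : p + q + r = 0)
    (hp : |p| < 100) (hq : |q| < 100) (hr : |r| < 100) :
    5 + 2 * (q * v₁ + r * (v₀ + v₁ + v₂)) - p ^ 2 - q ^ 2 - r ^ 2 ≤ cost g x L := by
  obtain ⟨a, L, rfl, h₃⟩ := map_fst_eq_cons h
  obtain ⟨b, L, rfl, h₄⟩ := map_fst_eq_cons h₃
  obtain ⟨c, L, rfl, h₅⟩ := map_fst_eq_cons h₄
  obtain ⟨d, L, rfl, h₆⟩ := map_fst_eq_cons h₅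
  obtain rfl := List.map_eq_nil_iff.1 h₆
  simp at h₀ h₁ h₂
  subst h₀ h₁ h₂
  obtain rfl : p = -(q + r) := by linarith
  simp only [cost_cons, cost_nil]
  have h0 : |(0 : ℝ)| < 100 := by norm_num
  linarith [ht _ x hp, ht _ (x + a) hq, ht _ (x + a + b) h0, ht _ (x + a + b + c) h0,
    ht _ (x + a + b + c + d) hr]

lemma le_cost_word_32123 (h : L.map Prod.fst = [2, 1, 0, 1, 2]) {p q : ℝ} (hp : |p| < 100)
    (hq : |q| < 100) :
    6 + 2 * p * (v₀ + v₁ + v₂) - 2 * p ^ 2 + 2 * q * (v₀ + v₁) - 2 * q ^ 2 ≤ cost g x L := by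
  obtain ⟨a, L, rfl, h₃⟩ := map_fst_eq_cons h
  obtain ⟨b, L, rfl, h₄⟩ := map_fst_eq_cons h₃
  obtain ⟨c, L, rfl, h₅⟩ := map_fst_eq_cons h₄
  obtain ⟨d, L, rfl, h₆⟩ := map_fst_eq_cons h₅
  obtain ⟨e, L, rfl, h₇⟩ := map_fst_eq_cons h₆
  obtain rfl := List.map_eq_nil_iff.1 h₇
  simp at h₀ h₁ h₂
  subst h₀ h₁ h₂
  simp only [cost_cons, cost_nil]
  have h0 : |(0 : ℝ)| < 100 := by norm_num
  have hp' : |-p| < 100 := by rwa [abs_neg]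
  have hq' : |-q| < 100 := by rwa [abs_neg]
  linarith [ht _ x hp', ht _ (x + a) hq', ht _ (x + a + b) h0, ht _ (x + a + b + c) h0,
    ht _ (x + a + b + c + d) hq, ht _ (x + a + b + c + d + e) hp]

end Bounds

/-- For a cost that is quadratic near the origin each of the four types has least cost for some
volumes. -/
theorem exists_leastCost_word (hg : IsConvexWell g) (hq : ∀ y, |y| ≤ 100 → g y = 1 + y ^ 2)
    {w : List (Fin 3)} (hw : w ∈ fourTypes) :
    ∃ x L, LeastCost g x L ∧ L.map Prod.fst = w ∧ 0 < vol 0 L ∧ vol 0 L < vol 1 L ∧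
      vol 1 L < vol 2 L := by
  have ht : ∀ c v, |c| < 100 → 1 + 2 * c * v - c ^ 2 ≤ g v := fun c v hc => tangent_le hg hq hc v
  -- Some minimizer has one of the four words, so a trial row `L₀` cheaper than every row of the
  -- other three words forces `w`.
  have key : ∀ (x₀ v₀ v₁ v₂ : ℝ) (L₀ : List (Fin 3 × ℝ)), (∀ a ∈ L₀, 0 ≤ a.2) →
      vol 0 L₀ = v₀ → vol 1 L₀ = v₁ → vol 2 L₀ = v₂ → 0 < v₀ → v₀ < v₁ → v₁ < v₂ →
      (∀ x L, vol 0 L = v₀ → vol 1 L = v₁ → vol 2 L = v₂ →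
        (L.map Prod.fst = [1, 0, 2] ∨ L.map Prod.fst = [2, 0, 1, 2] ∨
          L.map Prod.fst = [1, 2, 0, 2] ∨ L.map Prod.fst = [2, 1, 0, 1, 2]) →
        cost g x L ≤ cost g x₀ L₀ → L.map Prod.fst = w) →
      ∃ x L, LeastCost g x L ∧ L.map Prod.fst = w ∧ 0 < vol 0 L ∧ vol 0 L < vol 1 L ∧
        vol 1 L < vol 2 L := by
    rintro x₀ v₀ v₁ v₂ L₀ hL₀ rfl rfl rfl h₁ h₂ h₃ h
    obtain ⟨x, L, hL, hvol, hword⟩ := exists_leastCost_fourTypes hg hL₀ h₁ h₂ h₃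
    refine ⟨x, L, hL, h x L (hvol 0) (hvol 1) (hvol 2) hword
      (hL.le x₀ L₀ hL₀ fun i => (hvol i).symm), ?_⟩
    rw [hvol, hvol, hvol]
    exact ⟨h₁, h₂, h₃⟩
  simp only [fourTypes, mem_insert_iff, mem_singleton_iff] at hw
  rcases hw with rfl | rfl | rfl | rfl
  -- All volumes are small, so the number of division points decides: the other words cost at least
  -- 5.
  · refine key (-0.25) 0.1 0.2 0.3 [(1, 0.2), (0, 0.1), (2, 0.3)] (by simp; norm_num) (by simp)
      (by simp) (by simp) (by norm_num) (by norm_num) (by norm_num) fun x L h₀ h₁ h₂ h hle => ?_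
    have hcost : cost g (-0.25) [((1 : Fin 3), (0.2 : ℝ)), (0, 0.1), (2, 0.3)] = 4.19 := by
      simp only [cost_cons, cost_nil]
      rw [hq, hq, hq, hq] <;> norm_num [abs_le]
    rw [hcost] at hle
    rcases h with h | h | h | h
    · exact h
    · have := le_cost_word_3123 ht h₀ h₁ h₂ h (x := x) (p := 0) (q := 0) (r := 0) (s := 0)
      norm_num at this
      linarith
    · have := le_cost_word_2313 ht h₀ h₁ h₂ h (x := x) (p := 0) (q := 0) (r := 0)
      norm_num at this
      linarith
    · have := le_cost_word_32123 ht h₀ h₁ h₂ h (x := x) (p := 0) (q := 0)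
      norm_num at this
      linarith
  -- Only the third volume is large, so only that bubble is worth splitting. In the bounds for the
  -- other words, the tangency points are optimal division points or convenient approximations to
  -- them, here and below.
  · refine key (-2.15) 0.1 0.2 4 [(2, 2.05), (0, 0.1), (1, 0.2), (2, 1.95)] (by simp; norm_num)
      (by simp) (by simp) (by simp; norm_num) (by norm_num) (by norm_num) (by norm_num)
      fun x L h₀ h₁ h₂ h hle => ?_
    have hcost : cost g (-2.15) [((2 : Fin 3), (2.05 : ℝ)), (0, 0.1), (1, 0.2), (2, 1.95)]
        = 14.295 := by
      simp only [cost_cons, cost_nil]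
      rw [hq, hq, hq, hq, hq] <;> norm_num [abs_le]
    rw [hcost] at hle
    rcases h with h | h | h | h
    · have := le_cost_word_213 ht h₀ h₁ h₂ h (x := x) (p := -1.2) (q := -1) (r := -0.9) (s := 3.1)
      norm_num [abs_lt] at this
      linarith
    · exact h
    · have := le_cost_word_2313 ht h₀ h₁ h₂ h (x := x) (p := -1.5) (q := -1.3) (r := 2.8)
      norm_num [abs_lt] at this
      linarith
    · have := le_cost_word_32123 ht h₀ h₁ h₂ h (x := x) (p := 2.15) (q := 0)
      norm_num [abs_lt] at this
      linarith
  -- Two comparable large bubbles: the third is split around the tiny first one, with the second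
  -- left outside.
  · refine key (-8) 0.1 6 12 [(1, 6), (2, 1.95), (0, 0.1), (2, 10.05)] (by simp; norm_num)
      (by simp) (by simp) (by simp; norm_num) (by norm_num) (by norm_num) (by norm_num)
      fun x L h₀ h₁ h₂ h hle => ?_
    have hcost : cost g (-8) [((1 : Fin 3), (6 : ℝ)), (2, 1.95), (0, 0.1), (2, 10.05)]
        = 175.015 := by
      simp only [cost_cons, cost_nil]
      rw [hq, hq, hq, hq, hq] <;> norm_num [abs_le]
    rw [hcost] at hle
    rcases h with h | h | h | h
    · have := le_cost_word_213 ht h₀ h₁ h₂ h (x := x) (p := -7.55) (q := -1.55) (r := -1.45)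
        (s := 10.55)
      norm_num [abs_lt] at this
      linarith
    · have := le_cost_word_3123 ht h₀ h₁ h₂ h (x := x) (p := 9) (q := -2) (r := -2) (s := 4)
      norm_num [abs_lt] at this
      linarith
    · exact h
    · have := le_cost_word_32123 ht h₀ h₁ h₂ h (x := x) (p := 9) (q := 3)
      norm_num [abs_lt] at this
      linarith
  -- Volumes of widely different sizes: the concentric row pays for its sixth division point.
  · refine key (-15.05) 0.1 6 24 [(2, 12), (1, 3), (0, 0.1), (1, 3), (2, 12)] (by simp; norm_num)
      (by simp) (by simp; norm_num) (by simp; norm_num) (by norm_num) (by norm_num) (by norm_num)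
      fun x L h₀ h₁ h₂ h hle => ?_
    have hcost : cost g (-15.05) [((2 : Fin 3), (12 : ℝ)), (1, 3), (0, 0.1), (1, 3), (2, 12)]
        = 477.615 := by
      simp only [cost_cons, cost_nil]
      rw [hq, hq, hq, hq, hq, hq] <;> norm_num [abs_le]
    rw [hcost] at hle
    rcases h with h | h | h | h
    · have := le_cost_word_213 ht h₀ h₁ h₂ h (x := x) (p := -10.5) (q := -4.5) (r := -4.5)
        (s := 19.5)
      norm_num [abs_lt] at this
      linarith
    · have := le_cost_word_3123 ht h₀ h₁ h₂ h (x := x) (p := 15) (q := -2) (r := -2) (s := 4)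
      norm_num [abs_lt] at this
      linarith
    · have := le_cost_word_2313 ht h₀ h₁ h₂ h (x := x) (p := -12) (q := -6) (r := 18)
      norm_num [abs_lt] at this
      linarith
    · exact h

end QuadraticCost

/-! ### A strictly log-convex density with quadratic cost. -/

section Density

/-- The slope of the logarithm of a density which equals `1 / cos ^ 2` on `[-X, X]`. -/
noncomputable def logSlope (X x : ℝ) : ℝ :=
  2 * Real.tan (max (-X) (min x X)) + (x - max (-X) (min x X))

/-- A density which equals `1 / cos ^ 2` on `[-X, X]`. -/
noncomputable def tanDensity (X x : ℝ) : ℝ := Real.exp (∫ t in 0..x, logSlope X t)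

variable {X : ℝ}

lemma clamp_mem (hX : 0 < X) (x : ℝ) : max (-X) (min x X) ∈ Icc (-X) X :=
  ⟨le_max_left _ _, max_le (by linarith) (min_le_right _ _)⟩

lemma Icc_subset_Ioo_pi_div_two (hX' : X < Real.pi / 2) :
    Icc (-X) X ⊆ Ioo (-(Real.pi / 2)) (Real.pi / 2) := Icc_subset_Ioo (by linarith) hX'

lemma continuous_logSlope (hX : 0 < X) (hX' : X < Real.pi / 2) : Continuous (logSlope X) := by
  have h : Continuous fun x : ℝ => max (-X) (min x X) := by fun_prop
  have := Real.continuousOn_tan_Ioo.comp_continuous h fun x =>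
    Icc_subset_Ioo_pi_div_two hX' (clamp_mem hX x)
  exact (continuous_const.mul this).add (continuous_id.sub h)

/-- The tangent of the clamped argument grows strictly inside `[-X, X]`, the excess over the clamp
grows strictly outside, and neither ever decreases because clamping is monotone and 1-Lipschitz. -/
lemma strictMono_logSlope (hX : 0 < X) (hX' : X < Real.pi / 2) : StrictMono (logSlope X) := by
  intro x y hxy
  have h₁ : max (-X) (min x X) ≤ max (-X) (min y X) :=
    max_le_max_left _ (min_le_min_right _ hxy.le)
  have h₂ : max (-X) (min y X) - max (-X) (min x X) ≤ y - x := by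
    rcases max_cases (-X) (min x X) with h | h <;> rcases max_cases (-X) (min y X) with h' | h' <;>
    rcases min_cases x X with h'' | h'' <;> rcases min_cases y X with h''' | h''' <;> linarith
  have hmono := Real.strictMonoOn_tan
  have hx := Icc_subset_Ioo_pi_div_two hX' (clamp_mem hX x)
  have hy := Icc_subset_Ioo_pi_div_two hX' (clamp_mem hX y)
  unfold logSlope
  rcases eq_or_lt_of_le h₁ with h | h
  · rw [h]; linarith
  · linarith [hmono hx hy h]

lemma logSlope_neg (hX : 0 < X) (x : ℝ) : logSlope X (-x) = -logSlope X x := by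
  have : max (-X) (min (-x) X) = -max (-X) (min x X) := by
    rcases max_cases (-X) (min x X) with h | h <;>
    rcases max_cases (-X) (min (-x) X) with h' | h' <;>
    rcases min_cases x X with h'' | h'' <;> rcases min_cases (-x) X with h''' | h''' <;> linarith
  unfold logSlope
  rw [this, Real.tan_neg]
  ring

lemma hasDerivAt_integral_logSlope (hX : 0 < X) (hX' : X < Real.pi / 2) (x : ℝ) :
    HasDerivAt (fun x => ∫ t in 0..x, logSlope X t) (logSlope X x) x :=
  intervalIntegral.integral_hasDerivAt_right
    ((continuous_logSlope hX hX').intervalIntegrable _ _)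
    (continuous_logSlope hX hX').stronglyMeasurable.stronglyMeasurableAtFilter
    (continuous_logSlope hX hX').continuousAt

lemma log_tanDensity (x : ℝ) : Real.log (tanDensity X x) = ∫ t in 0..x, logSlope X t :=
  Real.log_exp _

lemma tanDensity_neg (hX : 0 < X) (x : ℝ) : tanDensity X (-x) = tanDensity X x := by
  have := intervalIntegral.integral_comp_neg (a := 0) (b := x) (logSlope X)
  simp only [logSlope_neg hX, neg_zero, intervalIntegral.integral_neg] at this
  rw [tanDensity, tanDensity, intervalIntegral.integral_symm (-x) 0, ← this, neg_neg]

lemma strictConvexOn_log_tanDensity (hX : 0 < X) (hX' : X < Real.pi / 2) :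
    StrictConvexOn ℝ univ fun x => Real.log (tanDensity X x) := by
  simp only [log_tanDensity]
  refine StrictMono.strictConvexOn_univ_of_deriv ?_ ?_
  · exact continuous_iff_continuousAt.2 fun x =>
      (hasDerivAt_integral_logSlope hX hX' x).continuousAt
  · rw [show deriv (fun x => ∫ t in 0..x, logSlope X t) = logSlope X from
      funext fun x => (hasDerivAt_integral_logSlope hX hX' x).deriv]
    exact strictMono_logSlope hX hX'

lemma contDiff_tanDensity (hX : 0 < X) (hX' : X < Real.pi / 2) : ContDiff ℝ 1 (tanDensity X) := by
  have : ContDiff ℝ 1 fun x => ∫ t in 0..x, logSlope X t := by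
    rw [contDiff_one_iff_deriv]
    refine ⟨fun x => (hasDerivAt_integral_logSlope hX hX' x).differentiableAt, ?_⟩
    rw [show deriv (fun x => ∫ t in 0..x, logSlope X t) = logSlope X from
      funext fun x => (hasDerivAt_integral_logSlope hX hX' x).deriv]
    exact continuous_logSlope hX hX'
  exact Real.contDiff_exp.comp this

lemma isSymmLogConvex_tanDensity (hX : 0 < X) (hX' : X < Real.pi / 2) :
    IsSymmLogConvex (tanDensity X) where
  pos x := Real.exp_pos _
  even := tanDensity_neg hX
  convex := (strictConvexOn_log_tanDensity hX hX').convexOn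
  lt x hx := by
    have h := (strictConvexOn_log_tanDensity hX hX').2 (mem_univ x) (mem_univ (-x))
      (fun h => hx (by linarith)) (show (0 : ℝ) < 1 / 2 by norm_num)
      (show (0 : ℝ) < 1 / 2 by norm_num) (by norm_num)
    simp only [tanDensity_neg hX, smul_eq_mul] at h
    rw [show 1 / 2 * x + 1 / 2 * -x = 0 by ring] at h
    refine (Real.log_lt_log_iff (x := tanDensity X 0) (y := tanDensity X x) (Real.exp_pos _) (Real.exp_pos _)).1 ?_
    linarith

lemma uIcc_zero_subset {x : ℝ} (hx : x ∈ Icc (-X) X) : uIcc 0 x ⊆ Icc (-X) X :=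
  uIcc_subset_Icc ⟨by linarith [hx.1, hx.2], by linarith [hx.1, hx.2]⟩ hx

lemma tanDensity_eq (hX : 0 < X) (hX' : X < Real.pi / 2) {x : ℝ} (hx : x ∈ Icc (-X) X) :
    tanDensity X x = 1 / Real.cos x ^ 2 := by
  have hcos : ∀ y ∈ Icc (-X) X, 0 < Real.cos y := fun y hy =>
    Real.cos_pos_of_mem_Ioo (Icc_subset_Ioo_pi_div_two hX' hy)
  have : ∫ t in 0..x, logSlope X t = -2 * Real.log (Real.cos x) - -2 * Real.log (Real.cos 0) := by
    refine intervalIntegral.integral_eq_sub_of_hasDerivAt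
      (f := fun t => -2 * Real.log (Real.cos t)) (fun t ht => ?_)
      ((continuous_logSlope hX hX').intervalIntegrable _ _)
    have ht' := uIcc_zero_subset hx ht
    have h := (((Real.hasDerivAt_cos t).log (hcos t ht').ne').const_mul (-2))
    refine h.congr_deriv ?_
    rw [logSlope, min_eq_left ht'.2, max_eq_right ht'.1, Real.tan_eq_sin_div_cos]
    ring
  rw [tanDensity, this, Real.cos_zero, Real.log_one, mul_zero, sub_zero,
    show -2 * Real.log (Real.cos x) = -(Real.log (Real.cos x) + Real.log (Real.cos x)) by ring,
    Real.exp_neg, Real.exp_add, Real.exp_log (hcos x hx), one_div, sq]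

/-- Since `1 / cos ^ 2` is the derivative of `tan`, the volume coordinate is `tan x`, and `1 / cos ^
2` equals `1 + tan ^ 2`. -/
lemma pointCost_tanDensity (hX : 0 < X) (hX' : X < Real.pi / 2) {y : ℝ} (hy : |y| ≤ Real.tan X) :
    (isSymmLogConvex_tanDensity hX hX').pointCost y = 1 + y ^ 2 := by
  set hf := isSymmLogConvex_tanDensity hX hX'
  have hXX : Real.arctan (Real.tan X) = X := Real.arctan_tan (by linarith) hX'
  have hx : Real.arctan y ∈ Icc (-X) X := by
    rw [abs_le] at hy
    constructor
    · rw [← hXX, ← Real.arctan_neg]; exact Real.arctan_strictMono.monotone hy.1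
    · rw [← hXX]; exact Real.arctan_strictMono.monotone hy.2
  set x := Real.arctan y with hxy
  have hcos : ∀ y ∈ Icc (-X) X, Real.cos y ≠ 0 := fun y hy =>
    (Real.cos_pos_of_mem_Ioo (Icc_subset_Ioo_pi_div_two hX' hy)).ne'
  have hvol : hf.volumeCoord x = y := by
    rw [hf.volumeCoord_apply, intervalIntegral.integral_eq_sub_of_hasDerivAt (f := Real.tan)
      (fun t ht => ?_) (hf.intervalIntegrable _ _), Real.tan_zero, sub_zero, hxy, Real.tan_arctan]
    have ht' := uIcc_zero_subset hx ht
    rw [tanDensity_eq hX hX' ht']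
    exact Real.hasDerivAt_tan (hcos t ht')
  rw [← hvol, hf.pointCost_volumeCoord, hvol, tanDensity_eq hX hX' hx, hxy, Real.cos_sq_arctan,
    one_div_one_div]

end Density

theorem theorem1 :
    (∀ f : ℝ → ℝ, (∀ x, 0 < f x) → (∀ x, f (-x) = f x) →
      ConvexOn ℝ Set.univ (fun x => Real.log (f x)) → (∀ x, x ≠ 0 → f 0 < f x) →
      ∀ V : Fin 3 → ℝ, 0 < V 0 → V 0 ≤ V 1 → V 1 ≤ V 2 →
      ∀ E : Fin 3 → Set ℝ, IsPerimeterMinimizing f V E →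
        ∃ w ∈ fourTypes, IsOfType V w E ∨ IsOfType V w (reflectBubble E)) ∧
    (∃ f : ℝ → ℝ, (∀ x, 0 < f x) ∧ (∀ x, f (-x) = f x) ∧
      StrictConvexOn ℝ Set.univ (fun x => Real.log (f x)) ∧ ContDiff ℝ 1 f ∧
      ∀ w ∈ fourTypes, ∃ V : Fin 3 → ℝ, 0 < V 0 ∧ V 0 ≤ V 1 ∧ V 1 ≤ V 2 ∧
        ∃ E : Fin 3 → Set ℝ, IsPerimeterMinimizing f V E ∧ HasLayout w E) := by
  refine ⟨fun f hpos heven hconv hmin V h₀ h₁ h₂ E hE =>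
    IsSymmLogConvex.exists_isOfType ⟨hpos, heven, hconv, hmin⟩ h₀ h₁ h₂ hE, ?_⟩
  -- With `X = arctan 100` the cost is quadratic exactly on the range `|y| ≤ 100` required by
  -- `exists_leastCost_word`.
  have hX : 0 < Real.arctan 100 := Real.arctan_pos.2 (by norm_num)
  have hX' := Real.arctan_lt_pi_div_two 100
  have hf := isSymmLogConvex_tanDensity hX hX'
  refine ⟨tanDensity (Real.arctan 100), hf.pos, hf.even, strictConvexOn_log_tanDensity hX hX',
    contDiff_tanDensity hX hX', fun w hw => ?_⟩
  obtain ⟨x, L, hL, hLw, h₀, h₁, h₂⟩ := exists_leastCost_word hf.isConvexWell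
    (fun y hy => pointCost_tanDensity hX hX' (by rwa [Real.tan_arctan])) hw
  exact ⟨fun i => vol i L, h₀, h₁.le, h₂.le, _, hf.isPerimeterMinimizing_region hL h₀,
    hasLayout_of_ae_eq_region hf.volumeCoord.symm.strictMono hL.pos (fun _ => ae_eq_refl _) hLw⟩
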